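/- Let $\Gamma=(V,E)$ be a finite directed graph without parallel edges (loops allowed), strongly connected and aperiodic, with $V=\{0,1,\dots,N\}$, and let $O:V\to\{-1,1\}$. Let $\Sigma$ be the set of infinite paths $a=(a_k)_{k\ge 0}$ in $\Gamma$ and $\sigma$ the shift. For sequences $a,b$ put $a<b$ if for some $n\ge 0$ we have $a_k=b_k$ for all $k<n$ and $\prod_{k<n}O(a_k)\,(a_n-b_n)<0$; for finite words put $u<v$ if the same holds for some $n<\min(|u|,|v|)$. A sequence $a\in\Sigma$ is admissible if $a_0=N$ and $\sigma^n(a)\le a$ for all $n\ge 0$. For a finite word $w$ let $\mathrm{sgn}(w)=\prod_k O(w_k)$. The word $w$ is periodic if it starts with $N$ and $w^\infty\in\Sigma$; extremal if it is periodic and $w^\infty$ is admissible; admissible if it is extremal and $\mathrm{sgn}(w)=1$; irreducible if it is not a concatenation of two or more copies of one word. Let $W_n$ be the set of periodic words of length $n$, linearly ordered by $\le$. A pair $(w,w')$ of words in $W_n$ is a tuning pair if $w$ is admissible, $w'$ is extremal with $\mathrm{sgn}(w')=-1$, and $w'$ is the immediate successor of $w$ in $W_n$. The pair $(\Gamma,O)$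 is tunable if (1) there is a periodic word $w_{\min}$ in which $N$ occurs exactly once, with $\mathrm{sgn}(w_{\min})=-1$, such that $w_{\min}N$ is the minimal element of $W_{|w_{\min}|+1}$; and (2) every extremal irreducible word $a$ with $\mathrm{sgn}(a)=-1$ either equals $w_{\min}^k$ for some odd $k$ or is a member of a tuning pair. An admissible word is nonrenormalizable if it is not a tuning, that is, not obtained from a word $v=v_0\cdots v_{m-1}$ by replacing each letter $0$ by $w$ and each letter $1$ by $w'$, where $(w,w')$ is a tuning pair and $v$ is an admissible word for the complete directed graph with loops on $\{0,1\}$ with signs $0\mapsto 1$, $1\mapsto -1$. Theorem. Assume that $(\Gamma,O)$ is tunable. Let $a$ be a nonrenormalizable word and $b$ an admissible word with $b^\infty\le a^\infty$, and let $n$ be a positive integer. Then there is a (possibly empty) word $c$ such that $a^n c\, b^n$ is admissible. -/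

import Mathlib

/-! Symbolic dynamics of infinite paths on a finite directed graph with vertex set
`{0, …, N}` (the type `Fin (N + 1)`, loops allowed), ordered by a sign function
`O : {0, …, N} → {-1, 1}`. -/

namespace SignedShift

variable {N : ℕ}

/-- There is a walk with `n` edges from `i` to `j`. -/
def HasWalk (Γ : Digraph (Fin (N + 1))) (n : ℕ) (i j : Fin (N + 1)) : Prop :=
  ∃ p : ℕ → Fin (N + 1), p 0 = i ∧ p n = j ∧ ∀ k < n, Γ.Adj (p k) (p (k + 1))

/-- Strong connectedness. -/
def StronglyConnected (Γ : Digraph (Fin (N + 1))) : Prop :=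
  ∀ i j, ∃ n, HasWalk Γ n i j

/-- Aperiodicity: the lengths of the closed walks have greatest common divisor `1`. -/
def Aperiodic (Γ : Digraph (Fin (N + 1))) : Prop :=
  ∀ d : ℕ, (∀ i n, HasWalk Γ n i i → d ∣ n) → d = 1

/-- The space of infinite paths. -/
def paths (Γ : Digraph (Fin (N + 1))) : Set (ℕ → Fin (N + 1)) :=
  {a | ∀ n, Γ.Adj (a n) (a (n + 1))}

/-- The `n`-fold shift of a sequence. -/
def shift (n : ℕ) (a : ℕ → Fin (N + 1)) : ℕ → Fin (N + 1) := fun k => a (k + n)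

/-- The strict twisted lexicographic order on sequences. -/
def SeqLT (O : Fin (N + 1) → ℤˣ) (a b : ℕ → Fin (N + 1)) : Prop :=
  ∃ n, (∀ k < n, a k = b k) ∧
    (∏ k ∈ Finset.range n, ((O (a k) : ℤˣ) : ℤ)) * (((a n : ℕ) : ℤ) - ((b n : ℕ) : ℤ)) < 0

/-- The associated non-strict order on sequences. -/
def SeqLE (O : Fin (N + 1) → ℤˣ) (a b : ℕ → Fin (N + 1)) : Prop :=
  SeqLT O a b ∨ a = b

/-- Admissible sequences. -/
def SeqAdmissible (Γ : Digraph (Fin (N + 1))) (O : Fin (N + 1) → ℤˣ)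
    (a : ℕ → Fin (N + 1)) : Prop :=
  a ∈ paths Γ ∧ a 0 = Fin.last N ∧ ∀ n, SeqLE O (shift n a) a

/-- The sign of a word. -/
def sgn (O : Fin (N + 1) → ℤˣ) (w : List (Fin (N + 1))) : ℤˣ := (w.map O).prod

/-- The concatenation of `n` copies of a word. -/
def wpow (w : List (Fin (N + 1))) (n : ℕ) : List (Fin (N + 1)) :=
  (List.replicate n w).flatten

/-- The infinite repetition of a word; it is used for nonempty words only. -/
def wrep (w : List (Fin (N + 1))) : ℕ → Fin (N + 1) :=
  fun n => w.getD (n % w.length) (Fin.last N)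

/-- The strict order on finite words: the first difference, at a position that belongs to
both words, is decided by the sign of the common prefix. -/
def WordLT (O : Fin (N + 1) → ℤˣ) (u v : List (Fin (N + 1))) : Prop :=
  ∃ (j : ℕ) (hu : j < u.length) (hv : j < v.length), u.take j = v.take j ∧
    ((sgn O (u.take j) : ℤˣ) : ℤ) * (((u[j] : ℕ) : ℤ) - ((v[j] : ℕ) : ℤ)) < 0

/-- The associated non-strict order on finite words. -/
def WordLE (O : Fin (N + 1) → ℤˣ) (u v : List (Fin (N + 1))) : Prop :=
  WordLT O u v ∨ u = v

/-- Periodic words; they start with `N`, hence they are nonempty. -/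
def IsPeriodicWord (Γ : Digraph (Fin (N + 1))) (w : List (Fin (N + 1))) : Prop :=
  w.head? = some (Fin.last N) ∧ wrep w ∈ paths Γ

/-- Irreducible words. -/
def IsIrreducibleWord (w : List (Fin (N + 1))) : Prop :=
  ¬ ∃ (u : List (Fin (N + 1))) (k : ℕ), 2 ≤ k ∧ w = wpow u k

/-- Extremal words. -/
def IsExtremal (Γ : Digraph (Fin (N + 1))) (O : Fin (N + 1) → ℤˣ)
    (w : List (Fin (N + 1))) : Prop :=
  IsPeriodicWord Γ w ∧ SeqAdmissible Γ O (wrep w)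

/-- Admissible words. -/
def IsAdmissible (Γ : Digraph (Fin (N + 1))) (O : Fin (N + 1) → ℤˣ)
    (w : List (Fin (N + 1))) : Prop :=
  IsExtremal Γ O w ∧ sgn O w = 1

/-- The set of periodic words of length `n`. -/
def periodicWords (Γ : Digraph (Fin (N + 1))) (n : ℕ) : Set (List (Fin (N + 1))) :=
  {w | IsPeriodicWord Γ w ∧ w.length = n}

/-- `a'` is the immediate successor of `a` among the periodic words of length `n`. -/
def IsNext (Γ : Digraph (Fin (N + 1))) (O : Fin (N + 1) → ℤˣ) (n : ℕ)
    (a a' : List (Fin (N + 1))) : Prop :=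
  a ∈ periodicWords Γ n ∧ a' ∈ periodicWords Γ n ∧ WordLT O a a' ∧
    ∀ c ∈ periodicWords Γ n, ¬ (WordLT O a c ∧ WordLT O c a')

/-- Tuning pairs. -/
def IsTuningPair (Γ : Digraph (Fin (N + 1))) (O : Fin (N + 1) → ℤˣ)
    (a a' : List (Fin (N + 1))) : Prop :=
  IsAdmissible Γ O a ∧ IsExtremal Γ O a' ∧ sgn O a' = -1 ∧ IsNext Γ O a.length a a'

/-- Tunability of `(Γ, O)`. -/
def IsTunable (Γ : Digraph (Fin (N + 1))) (O : Fin (N + 1) → ℤˣ) : Prop :=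
  ∃ wmin : List (Fin (N + 1)),
    (IsPeriodicWord Γ wmin ∧ wmin.count (Fin.last N) = 1 ∧ sgn O wmin = -1 ∧
      wmin ++ [Fin.last N] ∈ periodicWords Γ (wmin.length + 1) ∧
      ∀ c ∈ periodicWords Γ (wmin.length + 1), WordLE O (wmin ++ [Fin.last N]) c) ∧
    ∀ a : List (Fin (N + 1)), IsExtremal Γ O a → IsIrreducibleWord a → sgn O a = -1 →
      (∃ k, Odd k ∧ a = wpow wmin k) ∨
        ∃ b, IsTuningPair Γ O a b ∨ IsTuningPair Γ O b a

/-- The unimodal graph: vertices `0, 1` and all four edges. -/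
def unimodalGraph : Digraph (Fin (1 + 1)) where
  Adj _ _ := True

/-- The unimodal signs: `0 ↦ 1`, `1 ↦ -1`. -/
def unimodalSign : Fin (1 + 1) → ℤˣ := ![1, -1]

/-- Substitution of `w` for the letter `0` and of `w'` for the letter `1` in `v`. -/
def tune (w w' : List (Fin (N + 1))) (v : List (Fin (1 + 1))) : List (Fin (N + 1)) :=
  v.flatMap fun i => if i = 0 then w else w'

/-- `a` is the tuning of the first word of a tuning pair by an admissible unimodal word. -/
def IsTuning (Γ : Digraph (Fin (N + 1))) (O : Fin (N + 1) → ℤˣ)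
    (a : List (Fin (N + 1))) : Prop :=
  ∃ (w w' : List (Fin (N + 1))) (v : List (Fin (1 + 1))),
    IsTuningPair Γ O w w' ∧ IsAdmissible unimodalGraph unimodalSign v ∧ a = tune w w' v

/-- Nonrenormalizable words: admissible words that are not tunings. -/
def IsNonrenormalizable (Γ : Digraph (Fin (N + 1))) (O : Fin (N + 1) → ℤˣ)
    (a : List (Fin (N + 1))) : Prop :=
  IsAdmissible Γ O a ∧ ¬ IsTuning Γ O a

end SignedShift

/-! The argument is carried out for sequences. Write `u ≪ v` if `u < v` is decided within a common
range of positions (`LTb`), `g` for the minimal word `w_min`, and let `x = a^∞ > b^∞`.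

Which continuations of `a^K` create no tail above `x` depends on the borders of a period of `x`, the
prefixes of the period that are also suffixes of it. If the period is minimal, all
borders are negative (`IsTop.sgn_border`), so a border only bounds the continuations after `a^K`
from below, and the longest border gives the strongest bound (`IsTop.shift_mono`). Hence one looks
for a word `q` that exceeds this bound and all of whose tails are `≪ x`; such a word `Escapes` from
`a`. Given `q`, the word `a^K q g^e b^n` is maximal for large `K`, with `e ∈ {0, 1}` chosen to make
the sign positive (`Base.wrep_admissible`); tails that start in `b^n` are controlled by
`cat_le_of_suffix`.

Escaping words exist by induction on the length of the irreducible root of `a`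
(`Base.exists_escapes`). The longest border `w'` is itself a negative irreducible extremal word
(`IsTop.border_strict`), so tunability makes it `g` or part of a tuning pair `(w, w')`. In the first
case, or if no border is followed by `N`, the word `g` escapes. Otherwise `x ≥ w'^∞`, and since `a`
is not a tuning, `x > w' w^∞`, which says that `w^∞` exceeds the bound given by `w'`; one continues
with a high power of `w` and then with a word that escapes from the root of `w`. If `w` itself is a
tuning, it is first replaced by the word of the shortest pair whose window contains `w^∞`
(`Base.exists_noWindow`).

Two facts about the graph are needed, and both use that predecessors of negative extremal words are
admissible. No path is smaller than `gN` (`Base.not_ltb`), and an admissible word `a` with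
`w'^∞ ≤ a^∞ ≤ w' w^∞` is a concatenation of copies of `w` and `w'` (`Base.starts_with`,
`Base.exists_tune`). A violation of either provides a loop `h` for which `w' h w' … w'` (with `g` as
`w'` in the first case) is a negative extremal word whose predecessor is not maximal
(`Base.exists_between`). -/

namespace SignedShift

variable {N : ℕ} {O : Fin (N + 1) → ℤˣ} {Γ : Digraph (Fin (N + 1))}

/-! ### The order and its finite truncations -/

/-- The sign of the first `n` letters of a sequence. -/
def psgn (O : Fin (N + 1) → ℤˣ) (a : ℕ → Fin (N + 1)) (n : ℕ) : ℤˣ :=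
  ∏ k ∈ Finset.range n, O (a k)

/-- `a < b` in the twisted order, and the first difference occurs before position `n`. -/
def LTb (O : Fin (N + 1) → ℤˣ) (n : ℕ) (a b : ℕ → Fin (N + 1)) : Prop :=
  ∃ i < n, (∀ k < i, a k = b k) ∧
    ((psgn O a i : ℤˣ) : ℤ) * (((a i : ℕ) : ℤ) - ((b i : ℕ) : ℤ)) < 0

theorem psgn_congr {a b : ℕ → Fin (N + 1)} {n : ℕ} (h : ∀ k < n, a k = b k) :
    psgn O a n = psgn O b n :=
  Finset.prod_congr rfl fun k hk => by rw [h k (Finset.mem_range.1 hk)]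

theorem seqLT_iff {a b : ℕ → Fin (N + 1)} : SeqLT O a b ↔ ∃ n, LTb O n a b := by
  constructor
  · rintro ⟨i, h1, h2⟩
    refine ⟨i + 1, i, Nat.lt_succ_self i, h1, ?_⟩
    simpa [psgn, Units.coe_prod] using h2
  · rintro ⟨n, i, -, h1, h2⟩
    refine ⟨i, h1, ?_⟩
    simpa [psgn, Units.coe_prod] using h2

theorem LTb.seqLT {n : ℕ} {a b : ℕ → Fin (N + 1)} (h : LTb O n a b) : SeqLT O a b :=
  seqLT_iff.2 ⟨n, h⟩

theorem LTb.le {n : ℕ} {a b : ℕ → Fin (N + 1)} (h : LTb O n a b) : SeqLE O a b :=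
  Or.inl h.seqLT

theorem LTb.mono {n m : ℕ} {a b : ℕ → Fin (N + 1)} (h : LTb O n a b) (hm : n ≤ m) :
    LTb O m a b := by
  obtain ⟨i, hi, h⟩ := h
  exact ⟨i, hi.trans_le hm, h⟩

theorem LTb.congr {n : ℕ} {a b a' b' : ℕ → Fin (N + 1)} (h : LTb O n a b)
    (ha : ∀ k < n, a k = a' k) (hb : ∀ k < n, b k = b' k) : LTb O n a' b' := by
  obtain ⟨i, hi, h1, h2⟩ := h
  refine ⟨i, hi, fun k hk => ?_, ?_⟩
  · rw [← ha k (hk.trans hi), ← hb k (hk.trans hi), h1 k hk]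
  · rw [← ha i hi, ← hb i hi, ← psgn_congr fun k hk => ha k (hk.trans hi)]
    exact h2

theorem LTb.trans {n m : ℕ} {a b c : ℕ → Fin (N + 1)} (h : LTb O n a b) (h' : LTb O m b c) :
    LTb O (min n m) a c := by
  obtain ⟨i, hi, h1, h2⟩ := h
  obtain ⟨j, hj, h3, h4⟩ := h'
  rcases lt_trichotomy i j with hij | rfl | hij
  · exact ⟨i, lt_min hi (hij.trans hj), fun k hk => by rw [h1 k hk, h3 k (hk.trans hij)],
      by rw [← h3 i hij]; exact h2⟩
  · refine ⟨i, lt_min hi hj, fun k hk => by rw [h1 k hk, h3 k hk], ?_⟩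
    rw [← psgn_congr h1] at h4
    linarith
  · refine ⟨j, lt_min (hij.trans hi) hj, fun k hk => by rw [h1 k (hk.trans hij), h3 k hk], ?_⟩
    rw [psgn_congr fun k hk => h1 k (hk.trans hij), h1 j hij]
    exact h4

theorem LTb.irrefl {n : ℕ} {a : ℕ → Fin (N + 1)} : ¬ LTb O n a a := by
  rintro ⟨i, -, -, h⟩
  simp at h

theorem LTb.asymm {n m : ℕ} {a b : ℕ → Fin (N + 1)} (h : LTb O n a b) : ¬ LTb O m b a :=
  fun h' => (h.trans h').irrefl

/-- A strict inequality decided before position `n` contradicts agreement up to `n`. -/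
theorem LTb.not_agree {n : ℕ} {a b : ℕ → Fin (N + 1)} (h : LTb O n a b) :
    ¬ ∀ k < n, a k = b k :=
  fun h' => (h.congr h' fun _ _ => rfl).irrefl

theorem LTb.trichotomy (O : Fin (N + 1) → ℤˣ) (n : ℕ) (a b : ℕ → Fin (N + 1)) :
    LTb O n a b ∨ (∀ k < n, a k = b k) ∨ LTb O n b a := by
  by_cases h : ∀ k < n, a k = b k
  · exact Or.inr (Or.inl h)
  · push Not at h
    classical
    obtain ⟨hin, hi⟩ := Nat.find_spec h
    have hmin : ∀ k < Nat.find h, a k = b k := fun k hk => by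
      have := Nat.find_min h hk
      push Not at this
      exact this (hk.trans hin)
    set i := Nat.find h
    have hne : ((a i : ℕ) : ℤ) - ((b i : ℕ) : ℤ) ≠ 0 := by
      intro h0
      exact hi (Fin.ext (by omega))
    rcases Int.units_eq_one_or (psgn O a i) with hs | hs <;> rcases lt_or_gt_of_ne hne with hd | hd
    · exact Or.inl ⟨i, hin, hmin, by rw [hs]; simpa using hd⟩
    · refine Or.inr (Or.inr ⟨i, hin, fun k hk => (hmin k hk).symm, ?_⟩)
      rw [← psgn_congr hmin, hs]; simp only [Units.val_one]; omega
    · refine Or.inr (Or.inr ⟨i, hin, fun k hk => (hmin k hk).symm, ?_⟩)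
      rw [← psgn_congr hmin, hs]; simp only [Units.val_neg, Units.val_one]; omega
    · exact Or.inl ⟨i, hin, hmin, by rw [hs]; simp only [Units.val_neg, Units.val_one]; omega⟩

theorem SeqLE.refl (a : ℕ → Fin (N + 1)) : SeqLE O a a := Or.inr rfl

theorem SeqLE.trans_ltb {n : ℕ} {a b c : ℕ → Fin (N + 1)} (h : SeqLE O a b)
    (h' : LTb O n b c) : LTb O n a c := by
  rcases h with h | rfl
  · obtain ⟨m, h⟩ := seqLT_iff.1 h
    exact (h.trans h').mono (min_le_right _ _)
  · exact h'

theorem LTb.trans_le {n : ℕ} {a b c : ℕ → Fin (N + 1)} (h : LTb O n a b)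
    (h' : SeqLE O b c) : LTb O n a c := by
  rcases h' with h' | rfl
  · obtain ⟨m, h'⟩ := seqLT_iff.1 h'
    exact (h.trans h').mono (min_le_left _ _)
  · exact h

theorem SeqLE.trans {a b c : ℕ → Fin (N + 1)} (h : SeqLE O a b) (h' : SeqLE O b c) :
    SeqLE O a c := by
  rcases h' with h' | rfl
  · obtain ⟨m, h'⟩ := seqLT_iff.1 h'
    exact (h.trans_ltb h').le
  · exact h

theorem SeqLE.not_lt {n : ℕ} {a b : ℕ → Fin (N + 1)} (h : SeqLE O a b) : ¬ LTb O n b a :=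
  fun h' => (h.trans_ltb h').irrefl

theorem seqLT_or_le (O : Fin (N + 1) → ℤˣ) (a b : ℕ → Fin (N + 1)) :
    SeqLT O a b ∨ SeqLE O b a := by
  by_cases hab : a = b
  · exact Or.inr (Or.inr hab.symm)
  · obtain ⟨k, hk⟩ := Function.ne_iff.1 hab
    rcases LTb.trichotomy O (k + 1) a b with h | h | h
    · exact Or.inl h.seqLT
    · exact absurd (h k k.lt_succ_self) hk
    · exact Or.inr h.le

theorem SeqLE.antisymm {a b : ℕ → Fin (N + 1)} (h : SeqLE O a b) (h' : SeqLE O b a) :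
    a = b := by
  rcases h with h | h
  · obtain ⟨m, h⟩ := seqLT_iff.1 h
    exact absurd h h'.not_lt
  · exact h

/-- Up to position `n`, an inequality is either strict or an agreement. -/
theorem SeqLE.ltb_or_agree {a b : ℕ → Fin (N + 1)} (h : SeqLE O a b) (n : ℕ) :
    LTb O n a b ∨ ∀ k < n, a k = b k := by
  rcases LTb.trichotomy O n a b with h1 | h1 | h1
  · exact Or.inl h1
  · exact Or.inr h1
  · exact absurd h1 h.not_lt

theorem ltb_of_zero_lt {n : ℕ} (hn : 0 < n) {a b : ℕ → Fin (N + 1)} (h : a 0 < b 0) :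
    LTb O n a b := by
  refine ⟨0, hn, by simp, ?_⟩
  have : (a 0 : ℕ) < b 0 := h
  simp only [psgn, Finset.range_zero, Finset.prod_empty, Units.val_one]
  omega

theorem SeqLE.zero_le {a b : ℕ → Fin (N + 1)} (h : SeqLE O a b) : a 0 ≤ b 0 := by
  by_contra hlt
  exact h.not_lt (ltb_of_zero_lt one_pos (not_le.1 hlt))

/-! ### Words followed by sequences -/

/-- The sequence that starts with the word `u` and continues with `x`. -/
def cat (u : List (Fin (N + 1))) (x : ℕ → Fin (N + 1)) : ℕ → Fin (N + 1) :=
  fun k => u.getD k (x (k - u.length))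

/-- The word formed by the first `n` letters of a sequence. -/
def pre (x : ℕ → Fin (N + 1)) (n : ℕ) : List (Fin (N + 1)) := (List.range n).map x

theorem cat_of_lt {u : List (Fin (N + 1))} {x : ℕ → Fin (N + 1)} {k : ℕ} (hk : k < u.length) :
    cat u x k = u[k] := by
  simp [cat, hk]

theorem cat_of_ge {u : List (Fin (N + 1))} {x : ℕ → Fin (N + 1)} {k : ℕ} (hk : u.length ≤ k) :
    cat u x k = x (k - u.length) := by
  simp [cat, hk]

theorem cat_add (u : List (Fin (N + 1))) (x : ℕ → Fin (N + 1)) (k : ℕ) :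
    cat u x (u.length + k) = x k := by
  rw [cat_of_ge (Nat.le_add_right _ _), Nat.add_sub_cancel_left]

@[simp] theorem cat_nil (x : ℕ → Fin (N + 1)) : cat [] x = x := by
  funext k; simp [cat]

theorem cat_congr_lt {u : List (Fin (N + 1))} {x y : ℕ → Fin (N + 1)} {k : ℕ}
    (hk : k < u.length) : cat u x k = cat u y k := by
  rw [cat_of_lt hk, cat_of_lt hk]

theorem cat_append (u v : List (Fin (N + 1))) (x : ℕ → Fin (N + 1)) :
    cat (u ++ v) x = cat u (cat v x) := by
  funext k
  rcases lt_or_ge k u.length with h | h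
  · rw [cat_of_lt h, cat_of_lt (by simp; omega), List.getElem_append_left h]
  · rw [cat_of_ge h]
    rcases lt_or_ge (k - u.length) v.length with h' | h'
    · rw [cat_of_lt h', cat_of_lt (by simp; omega), List.getElem_append_right h]
    · rw [cat_of_ge h', cat_of_ge (by simp; omega), List.length_append, Nat.sub_sub]

theorem shift_add (m n : ℕ) (x : ℕ → Fin (N + 1)) : shift m (shift n x) = shift (m + n) x := by
  funext k; simp [shift, Nat.add_assoc]

@[simp] theorem shift_zero (x : ℕ → Fin (N + 1)) : shift 0 x = x := rfl

theorem shift_apply_zero (n : ℕ) (x : ℕ → Fin (N + 1)) : shift n x 0 = x n := by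
  simp [shift]

theorem shift_cat (u : List (Fin (N + 1))) (x : ℕ → Fin (N + 1)) (j : ℕ) :
    shift (u.length + j) (cat u x) = shift j x := by
  funext k
  rw [shift, show k + (u.length + j) = u.length + (k + j) by omega, cat_add, shift]

theorem shift_length_cat (u : List (Fin (N + 1))) (x : ℕ → Fin (N + 1)) :
    shift u.length (cat u x) = x := shift_cat u x 0

theorem shift_cat_drop (u : List (Fin (N + 1))) (x : ℕ → Fin (N + 1)) {j : ℕ}
    (hj : j ≤ u.length) : shift j (cat u x) = cat (u.drop j) x := by
  conv_lhs => rw [← List.take_append_drop j u, cat_append]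
  have := shift_length_cat (u.take j) (cat (u.drop j) x)
  rwa [List.length_take, min_eq_left hj] at this

@[simp] theorem length_pre (x : ℕ → Fin (N + 1)) (n : ℕ) : (pre x n).length = n := by
  simp [pre]

theorem cat_pre_of_lt {x y : ℕ → Fin (N + 1)} {n k : ℕ} (hk : k < n) :
    cat (pre x n) y k = x k := by
  rw [cat_of_lt (by simpa using hk)]
  simp [pre]

theorem cat_pre_shift (x : ℕ → Fin (N + 1)) (n : ℕ) : cat (pre x n) (shift n x) = x := by
  funext k
  rcases lt_or_ge k n with h | h
  · exact cat_pre_of_lt h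
  · rw [cat_of_ge (by simpa using h), length_pre, shift, Nat.sub_add_cancel h]

/-- A sequence that agrees with `u` on its first letters is `u` followed by its shift. -/
theorem eq_cat_shift {u : List (Fin (N + 1))} {x y : ℕ → Fin (N + 1)}
    (h : ∀ k < u.length, x k = cat u y k) : x = cat u (shift u.length x) := by
  funext k
  rcases lt_or_ge k u.length with hk | hk
  · rw [h k hk]; exact cat_congr_lt hk
  · rw [cat_of_ge hk, shift, Nat.sub_add_cancel hk]

/-- Words of equal length are determined by the sequences that they start. -/
theorem word_ext {u v : List (Fin (N + 1))} {x y : ℕ → Fin (N + 1)} (hl : u.length = v.length)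
    (h : ∀ k < u.length, cat u x k = cat v y k) : u = v := by
  refine List.ext_getElem hl fun k h1 h2 => ?_
  have := h k h1
  rwa [cat_of_lt h1, cat_of_lt h2] at this

theorem sgn_append (u v : List (Fin (N + 1))) : sgn O (u ++ v) = sgn O u * sgn O v := by
  simp [sgn]

@[simp] theorem sgn_nil : sgn O ([] : List (Fin (N + 1))) = 1 := rfl

theorem sgn_pre (x : ℕ → Fin (N + 1)) (n : ℕ) : sgn O (pre x n) = psgn O x n := by
  induction n with
  | zero => simp [pre, psgn]
  | succ n ih =>
    rw [psgn, Finset.prod_range_succ, ← psgn, ← ih]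
    simp [pre, sgn, List.range_succ]

theorem psgn_add (x : ℕ → Fin (N + 1)) (n i : ℕ) :
    psgn O x (n + i) = psgn O x n * psgn O (shift n x) i := by
  simp only [psgn, Finset.prod_range_add, shift]
  congr 1
  exact Finset.prod_congr rfl fun k _ => by rw [Nat.add_comm]

theorem pre_cat (u : List (Fin (N + 1))) (x : ℕ → Fin (N + 1)) : pre (cat u x) u.length = u := by
  refine word_ext (x := x) (y := x) (by simp) fun k hk => ?_
  rw [length_pre] at hk
  exact cat_pre_of_lt hk

theorem psgn_cat (u : List (Fin (N + 1))) (x : ℕ → Fin (N + 1)) (i : ℕ) :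
    psgn O (cat u x) (u.length + i) = sgn O u * psgn O x i := by
  rw [psgn_add, shift_length_cat, ← sgn_pre, pre_cat]

theorem sgn_eq_one_or (u : List (Fin (N + 1))) : sgn O u = 1 ∨ sgn O u = -1 :=
  Int.units_eq_one_or _

theorem LTb.cat_pos {u : List (Fin (N + 1))} (hu : sgn O u = 1) {n : ℕ}
    {x y : ℕ → Fin (N + 1)} (h : LTb O n x y) : LTb O (u.length + n) (cat u x) (cat u y) := by
  obtain ⟨i, hi, h1, h2⟩ := h
  refine ⟨u.length + i, by omega, fun k hk => ?_, ?_⟩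
  · rcases lt_or_ge k u.length with hk' | hk'
    · exact cat_congr_lt hk'
    · rw [cat_of_ge hk', cat_of_ge hk', h1 _ (by omega)]
  · rw [psgn_cat, cat_add, cat_add, hu, one_mul]
    exact h2

theorem LTb.cat_neg {u : List (Fin (N + 1))} (hu : sgn O u = -1) {n : ℕ}
    {x y : ℕ → Fin (N + 1)} (h : LTb O n x y) : LTb O (u.length + n) (cat u y) (cat u x) := by
  obtain ⟨i, hi, h1, h2⟩ := h
  refine ⟨u.length + i, by omega, fun k hk => ?_, ?_⟩
  · rcases lt_or_ge k u.length with hk' | hk'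
    · exact cat_congr_lt hk'
    · rw [cat_of_ge hk', cat_of_ge hk', h1 _ (by omega)]
  · rw [psgn_cat, cat_add, cat_add, hu, ← psgn_congr h1]
    simp only [Units.val_mul, Units.val_neg, Units.val_one]
    linarith

theorem SeqLE.cat_pos {u : List (Fin (N + 1))} (hu : sgn O u = 1)
    {x y : ℕ → Fin (N + 1)} (h : SeqLE O x y) : SeqLE O (cat u x) (cat u y) := by
  rcases h with h | rfl
  · obtain ⟨n, h⟩ := seqLT_iff.1 h
    exact (h.cat_pos hu).le
  · exact SeqLE.refl _

theorem SeqLE.cat_neg {u : List (Fin (N + 1))} (hu : sgn O u = -1)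
    {x y : ℕ → Fin (N + 1)} (h : SeqLE O x y) : SeqLE O (cat u y) (cat u x) := by
  rcases h with h | rfl
  · obtain ⟨n, h⟩ := seqLT_iff.1 h
    exact (h.cat_neg hu).le
  · exact SeqLE.refl _

theorem LTb.of_cat_pos {u : List (Fin (N + 1))} (hu : sgn O u = 1) {n : ℕ}
    {x y : ℕ → Fin (N + 1)} (h : LTb O (u.length + n) (cat u x) (cat u y)) : LTb O n x y := by
  rcases LTb.trichotomy O n x y with h1 | h1 | h1
  · exact h1
  · refine absurd (fun k hk => ?_) h.not_agree
    rcases lt_or_ge k u.length with hk' | hk'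
    · exact cat_congr_lt hk'
    · rw [cat_of_ge hk', cat_of_ge hk', h1 _ (by omega)]
  · exact absurd (h1.cat_pos hu) h.asymm

theorem LTb.of_cat_neg {u : List (Fin (N + 1))} (hu : sgn O u = -1) {n : ℕ}
    {x y : ℕ → Fin (N + 1)} (h : LTb O (u.length + n) (cat u y) (cat u x)) : LTb O n x y := by
  rcases LTb.trichotomy O n x y with h1 | h1 | h1
  · exact h1
  · refine absurd (fun k hk => ?_) h.not_agree
    rcases lt_or_ge k u.length with hk' | hk'
    · exact cat_congr_lt hk'
    · rw [cat_of_ge hk', cat_of_ge hk', h1 _ (by omega)]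
  · exact absurd (h1.cat_neg hu) h.asymm

theorem SeqLE.of_cat_pos {u : List (Fin (N + 1))} (hu : sgn O u = 1)
    {x y : ℕ → Fin (N + 1)} (h : SeqLE O (cat u x) (cat u y)) : SeqLE O x y := by
  rcases seqLT_or_le O y x with h1 | h1
  · obtain ⟨n, h1⟩ := seqLT_iff.1 h1
    exact absurd (h1.cat_pos hu) h.not_lt
  · exact h1

theorem SeqLE.of_cat_neg {u : List (Fin (N + 1))} (hu : sgn O u = -1)
    {x y : ℕ → Fin (N + 1)} (h : SeqLE O (cat u y) (cat u x)) : SeqLE O x y := by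
  rcases seqLT_or_le O y x with h1 | h1
  · obtain ⟨n, h1⟩ := seqLT_iff.1 h1
    exact absurd (h1.cat_neg hu) h.not_lt
  · exact h1

/-- If putting `u` in front does not decrease `x`, then `x` is at most the fixed point
`z` of this operation. -/
theorem le_of_le_cat {u : List (Fin (N + 1))} (hne : u ≠ [])
    {x z : ℕ → Fin (N + 1)} (hz : cat u z = z) (h : SeqLE O x (cat u x)) : SeqLE O x z := by
  have hl := List.length_pos_iff.2 hne
  rcases seqLT_or_le O z x with h1 | h1
  · obtain ⟨n, i, hi, h1, h2⟩ := seqLT_iff.1 h1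
    have h3 : LTb O (i + 1) z x := ⟨i, i.lt_succ_self, h1, h2⟩
    refine absurd (h3.congr (a' := cat u x) (fun k hk => ?_) fun _ _ => rfl) h.not_lt
    rw [← hz]
    rcases lt_or_ge k u.length with hk' | hk'
    · exact cat_congr_lt hk'
    · rw [cat_of_ge hk', cat_of_ge hk', h1 _ (by omega)]
  · exact h1

/-- If putting `u` in front does not increase `x`, then `x` is at least the fixed point
`z` of this operation. -/
theorem le_of_cat_le {u : List (Fin (N + 1))} (hne : u ≠ [])
    {x z : ℕ → Fin (N + 1)} (hz : cat u z = z) (h : SeqLE O (cat u x) x) : SeqLE O z x := by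
  have hl := List.length_pos_iff.2 hne
  rcases seqLT_or_le O x z with h1 | h1
  · obtain ⟨n, i, hi, h1, h2⟩ := seqLT_iff.1 h1
    have h3 : LTb O (i + 1) x z := ⟨i, i.lt_succ_self, h1, h2⟩
    refine absurd (h3.congr (b' := cat u x) (fun _ _ => rfl) fun k hk => ?_) h.not_lt
    rw [← hz]
    rcases lt_or_ge k u.length with hk' | hk'
    · exact cat_congr_lt hk'
    · rw [cat_of_ge hk', cat_of_ge hk', h1 _ (by omega)]
  · exact h1

/-- A word is smaller than another one iff the sequences that they start differ within
the common range, in the same direction. -/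
theorem wordLT_iff {u v : List (Fin (N + 1))} (x y : ℕ → Fin (N + 1)) :
    WordLT O u v ↔ LTb O (min u.length v.length) (cat u x) (cat v y) := by
  have key : ∀ j (hu : j < u.length), sgn O (u.take j) = psgn O (cat u x) j := by
    intro j hu
    have := psgn_cat (O := O) (u.take j) (cat (u.drop j) x) 0
    rw [← cat_append, List.take_append_drop, List.length_take, min_eq_left hu.le, add_zero] at this
    rw [this]; simp [psgn]
  have htake : ∀ j (hu : j < u.length) (hv : j < v.length), u.take j = v.take j ↔
      ∀ k < j, cat u x k = cat v y k := by
    intro j hu hv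
    constructor
    · intro h k hk
      rw [cat_of_lt (hk.trans hu), cat_of_lt (hk.trans hv)]
      have h1 : (u.take j)[k]'(by simp; omega) = (v.take j)[k]'(by simp; omega) := by
        simp only [h]
      simpa using h1
    · intro h
      refine List.ext_getElem (by simp; omega) fun k h1 h2 => ?_
      simp only [List.length_take, lt_min_iff] at h1 h2
      have := h k h1.1
      rw [cat_of_lt h1.2, cat_of_lt h2.2] at this
      simpa using this
  constructor
  · rintro ⟨j, hu, hv, h1, h2⟩
    refine ⟨j, lt_min hu hv, (htake j hu hv).1 h1, ?_⟩
    rw [← key j hu, cat_of_lt hu, cat_of_lt hv]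
    exact h2
  · rintro ⟨j, hj, h1, h2⟩
    obtain ⟨hu, hv⟩ := lt_min_iff.1 hj
    refine ⟨j, hu, hv, (htake j hu hv).2 h1, ?_⟩
    rw [← key j hu, cat_of_lt hu, cat_of_lt hv] at h2
    exact h2

/-! ### Periodic sequences and periodic words -/

theorem cat_wrep (u : List (Fin (N + 1))) : cat u (wrep u) = wrep u := by
  funext k
  rcases lt_or_ge k u.length with h | h
  · rw [cat_of_lt h, wrep, Nat.mod_eq_of_lt h]; simp [h]
  · rw [cat_of_ge h, wrep, wrep, Nat.mod_eq_sub_mod h]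

theorem eq_wrep {u : List (Fin (N + 1))} (hu : u ≠ []) {x : ℕ → Fin (N + 1)}
    (h : cat u x = x) : x = wrep u := by
  have hl := List.length_pos_iff.2 hu
  funext k
  induction k using Nat.strong_induction_on with
  | _ k ih =>
    rw [← h, ← cat_wrep]
    rcases lt_or_ge k u.length with hk | hk
    · exact cat_congr_lt hk
    · rw [cat_of_ge hk, cat_of_ge hk, ih _ (by omega)]

theorem shift_length_wrep (u : List (Fin (N + 1))) : shift u.length (wrep u) = wrep u := by
  conv_lhs => rw [← cat_wrep]
  exact shift_length_cat u _

theorem shift_mul_of_shift {x : ℕ → Fin (N + 1)} {p : ℕ} (h : shift p x = x) (k : ℕ) :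
    shift (k * p) x = x := by
  induction k with
  | zero => simp
  | succ k ih => rw [Nat.succ_mul, ← shift_add, h, ih]

theorem shift_mod_of_shift {x : ℕ → Fin (N + 1)} {p : ℕ} (h : shift p x = x) (n : ℕ) :
    shift (n % p) x = shift n x := by
  conv_rhs => rw [← Nat.mod_add_div' n p, ← shift_add, shift_mul_of_shift h]

theorem shift_iterate (n : ℕ) (x : ℕ → Fin (N + 1)) : (shift 1)^[n] x = shift n x := by
  induction n with
  | zero => rfl
  | succ n ih => rw [Function.iterate_succ_apply', ih, shift_add, Nat.add_comm 1 n]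

theorem shift_gcd {x : ℕ → Fin (N + 1)} {p r : ℕ} (hp : shift p x = x) (hr : shift r x = x) :
    shift (p.gcd r) x = x := by
  have h1 : Function.IsPeriodicPt (shift 1) p x := by
    rw [Function.IsPeriodicPt, Function.IsFixedPt, shift_iterate, hp]
  have h2 : Function.IsPeriodicPt (shift 1) r x := by
    rw [Function.IsPeriodicPt, Function.IsFixedPt, shift_iterate, hr]
  have := h1.gcd h2
  rwa [Function.IsPeriodicPt, Function.IsFixedPt, shift_iterate] at this

@[simp] theorem wpow_zero (u : List (Fin (N + 1))) : wpow u 0 = [] := rfl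

theorem wpow_succ (u : List (Fin (N + 1))) (k : ℕ) : wpow u (k + 1) = u ++ wpow u k := by
  simp [wpow, List.replicate_succ]

@[simp] theorem wpow_one (u : List (Fin (N + 1))) : wpow u 1 = u := by simp [wpow]

theorem wpow_add (u : List (Fin (N + 1))) (k l : ℕ) :
    wpow u (k + l) = wpow u k ++ wpow u l := by
  rw [wpow, wpow, wpow, ← List.flatten_append, List.replicate_append_replicate]

theorem wpow_mul (u : List (Fin (N + 1))) (k l : ℕ) : wpow u (k * l) = wpow (wpow u k) l := by
  induction l with
  | zero => simp
  | succ l ih => rw [Nat.mul_succ, Nat.add_comm (k * l) k, wpow_add, ih, wpow_succ]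

@[simp] theorem length_wpow (u : List (Fin (N + 1))) (k : ℕ) :
    (wpow u k).length = k * u.length := by simp [wpow]

theorem sgn_wpow (u : List (Fin (N + 1))) (k : ℕ) : sgn O (wpow u k) = sgn O u ^ k := by
  induction k with
  | zero => simp
  | succ k ih => rw [wpow_succ, sgn_append, ih, pow_succ']

theorem cat_wpow_of_cat {u : List (Fin (N + 1))} {x : ℕ → Fin (N + 1)} (h : cat u x = x)
    (k : ℕ) : cat (wpow u k) x = x := by
  induction k with
  | zero => simp
  | succ k ih => rw [wpow_succ, cat_append, ih, h]

theorem wpow_ne_nil {u : List (Fin (N + 1))} (hu : u ≠ []) {k : ℕ} (hk : k ≠ 0) :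
    wpow u k ≠ [] := by
  rw [← List.length_pos_iff, length_wpow]
  exact Nat.mul_pos (Nat.pos_of_ne_zero hk) (List.length_pos_iff.2 hu)

theorem wrep_wpow {u : List (Fin (N + 1))} (hu : u ≠ []) {k : ℕ} (hk : k ≠ 0) :
    wrep (wpow u k) = wrep u :=
  (eq_wrep (wpow_ne_nil hu hk) (cat_wpow_of_cat (cat_wrep u) k)).symm

/-- A period of `w^∞` that is shorter than `w` makes `w` reducible. -/
theorem IsIrreducibleWord.shift_ne {w : List (Fin (N + 1))} (hw : IsIrreducibleWord w) {r : ℕ}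
    (h0 : 0 < r) (hr : r < w.length) : shift r (wrep w) ≠ wrep w := by
  intro h
  have hg := shift_gcd (shift_length_wrep w) h
  set d := w.length.gcd r with hd
  have hdpos : 0 < d := Nat.gcd_pos_of_pos_right _ h0
  have hdle : d ≤ r := Nat.gcd_le_right _ h0
  obtain ⟨k, hk⟩ : d ∣ w.length := Nat.gcd_dvd_left _ _
  refine hw ⟨pre (wrep w) d, k, ?_, ?_⟩
  · by_contra hlt
    have : k ≤ 1 := by omega
    have : d * k ≤ d * 1 := Nat.mul_le_mul_left d this
    omega
  · refine word_ext (x := wrep w) (y := wrep w) (by simp [hk, Nat.mul_comm]) fun j _ => ?_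
    have := cat_pre_shift (wrep w) d
    rw [hg] at this
    rw [cat_wrep, cat_wpow_of_cat this]

theorem IsIrreducibleWord.ne_nil {w : List (Fin (N + 1))} (hw : IsIrreducibleWord w) : w ≠ [] := by
  rintro rfl
  exact hw ⟨[], 2, le_rfl, rfl⟩

/-- Every nonempty word is a power of an irreducible word. -/
theorem exists_irreducible_root (w : List (Fin (N + 1))) (hw : w ≠ []) :
    ∃ u k, IsIrreducibleWord u ∧ k ≠ 0 ∧ w = wpow u k := by
  induction hn : w.length using Nat.strong_induction_on generalizing w with
  | _ n ih =>
    by_cases h : IsIrreducibleWord w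
    · exact ⟨w, 1, h, one_ne_zero, by simp⟩
    · obtain ⟨u, k, hk, rfl⟩ := not_not.1 h
      have hu : u ≠ [] := by
        rintro rfl
        exact hw (by simp [wpow])
      have hl := List.length_pos_iff.2 hu
      obtain ⟨v, l, hv, hl0, rfl⟩ := ih u.length (by
        rw [← hn, length_wpow]; nlinarith) u hu rfl
      exact ⟨v, l * k, hv, by positivity, (wpow_mul v l k).symm⟩

theorem cat_zero {u : List (Fin (N + 1))} {z : ℕ → Fin (N + 1)}
    (hu : u.head? = some (Fin.last N)) : cat u z 0 = Fin.last N := by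
  cases u with
  | nil => simp at hu
  | cons a l => simpa [cat] using hu

theorem IsPeriodicWord.ne_nil {u : List (Fin (N + 1))} (h : IsPeriodicWord Γ u) : u ≠ [] := by
  rintro rfl
  simpa using h.1

theorem IsPeriodicWord.length_pos {u : List (Fin (N + 1))} (h : IsPeriodicWord Γ u) :
    0 < u.length := List.length_pos_iff.2 h.ne_nil

theorem IsPeriodicWord.cat_zero {u : List (Fin (N + 1))} (h : IsPeriodicWord Γ u)
    (z : ℕ → Fin (N + 1)) : cat u z 0 = Fin.last N := SignedShift.cat_zero h.1

theorem IsPeriodicWord.wrep_zero {u : List (Fin (N + 1))} (h : IsPeriodicWord Γ u) :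
    wrep u 0 = Fin.last N := by
  rw [← cat_wrep, h.cat_zero]

/-- A word is periodic iff it is a path that starts at `N` and can be followed by `N`. -/
theorem isPeriodicWord_iff {u : List (Fin (N + 1))} {z : ℕ → Fin (N + 1)}
    (hz : z 0 = Fin.last N) : IsPeriodicWord Γ u ↔
      u.head? = some (Fin.last N) ∧ ∀ k < u.length, Γ.Adj (cat u z k) (cat u z (k + 1)) := by
  have key : u.head? = some (Fin.last N) → ∀ k ≤ u.length, cat u z k = wrep u k := by
    intro h k hk
    rw [← cat_wrep]
    rcases hk.lt_or_eq with hk | rfl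
    · exact cat_congr_lt hk
    · rw [cat_of_ge le_rfl, cat_of_ge le_rfl, Nat.sub_self, hz, ← cat_wrep, cat_zero h]
  constructor
  · rintro ⟨h1, h2⟩
    refine ⟨h1, fun k hk => ?_⟩
    rw [key h1 k hk.le, key h1 (k + 1) hk]
    exact h2 k
  · rintro ⟨h1, h2⟩
    refine ⟨h1, fun n => ?_⟩
    have hl : 0 < u.length := by
      rw [List.length_pos_iff]; rintro rfl; simp at h1
    have hm := Nat.mod_lt n hl
    have := h2 _ hm
    rw [key h1 _ hm.le, key h1 _ hm] at this
    have e := shift_mod_of_shift (shift_length_wrep u) n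
    have e0 := congrFun e 0
    have e1 := congrFun e 1
    simp only [shift, Nat.zero_add, Nat.add_comm 1] at e0 e1
    rwa [e0, e1] at this

theorem IsPeriodicWord.cat_mem_paths {u : List (Fin (N + 1))} (h : IsPeriodicWord Γ u)
    {z : ℕ → Fin (N + 1)} (hz : z ∈ paths Γ) (h0 : z 0 = Fin.last N) : cat u z ∈ paths Γ := by
  intro k
  rcases lt_or_ge k u.length with hk | hk
  · exact ((isPeriodicWord_iff h0).1 h).2 k hk
  · rw [cat_of_ge hk, cat_of_ge (by omega), show k + 1 - u.length = k - u.length + 1 by omega]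
    exact hz _

theorem IsPeriodicWord.append {u v : List (Fin (N + 1))} (hu : IsPeriodicWord Γ u)
    (hv : IsPeriodicWord Γ v) : IsPeriodicWord Γ (u ++ v) := by
  refine (isPeriodicWord_iff hv.wrep_zero).2 ⟨?_, fun k hk => ?_⟩
  · rw [List.head?_append, hu.1]; rfl
  · rw [cat_append, cat_wrep]
    exact hu.cat_mem_paths hv.2 hv.wrep_zero k

theorem IsPeriodicWord.wpow {u : List (Fin (N + 1))} (hu : IsPeriodicWord Γ u) {k : ℕ}
    (hk : k ≠ 0) : IsPeriodicWord Γ (wpow u k) := by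
  induction k with
  | zero => exact absurd rfl hk
  | succ k ih =>
    rw [wpow_succ]
    rcases eq_or_ne k 0 with rfl | h
    · simpa using hu
    · exact hu.append (ih h)

theorem IsPeriodicWord.wpow_append {u v : List (Fin (N + 1))} (hu : IsPeriodicWord Γ u)
    (hv : IsPeriodicWord Γ v) (k : ℕ) : IsPeriodicWord Γ (SignedShift.wpow u k ++ v) := by
  rcases eq_or_ne k 0 with rfl | h
  · simpa using hv
  · exact (hu.wpow h).append hv

theorem isPeriodicWord_pre {x : ℕ → Fin (N + 1)} {n : ℕ}
    (hx : ∀ k < n, Γ.Adj (x k) (x (k + 1))) (h0 : x 0 = Fin.last N) (hn : 0 < n)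
    (hxn : x n = Fin.last N) :
    IsPeriodicWord Γ (pre x n) := by
  refine (isPeriodicWord_iff (z := shift n x) (by rw [shift_apply_zero, hxn])).2 ⟨?_, fun k hk => ?_⟩
  · obtain ⟨m, rfl⟩ := Nat.exists_eq_succ_of_ne_zero hn.ne'
    simp [pre, List.range_succ_eq_map, h0]
  · rw [cat_pre_shift]; exact hx k (by simpa using hk)

theorem shift_mem_paths {x : ℕ → Fin (N + 1)} (hx : x ∈ paths Γ) (n : ℕ) :
    shift n x ∈ paths Γ := fun k => by
  have := hx (k + n)
  rwa [Nat.add_right_comm] at this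

/-- A suffix of a periodic word is periodic if it starts with `N`. -/
theorem IsPeriodicWord.drop {u : List (Fin (N + 1))} (h : IsPeriodicWord Γ u) {n : ℕ}
    (hn : n < u.length) (h0 : wrep u n = Fin.last N) : IsPeriodicWord Γ (u.drop n) := by
  have e : u.drop n = pre (shift n (wrep u)) (u.length - n) := by
    refine word_ext (x := wrep u) (y := wrep u) (by simp) fun k hk => ?_
    rw [List.length_drop] at hk
    rw [cat_pre_of_lt hk, ← shift_cat_drop _ _ hn.le, cat_wrep]
  rw [e]
  refine isPeriodicWord_pre (fun k _ => shift_mem_paths h.2 n k) (by rw [shift_apply_zero, h0]) (by omega) ?_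
  rw [shift, Nat.sub_add_cancel hn.le]
  have := congrFun (shift_length_wrep u) 0
  rw [shift_apply_zero] at this
  rw [this, h.wrep_zero]

theorem IsPeriodicWord.of_append_right {u v : List (Fin (N + 1))} (hv : IsPeriodicWord Γ (u ++ v))
    (h0 : v.head? = some (Fin.last N)) : IsPeriodicWord Γ v := by
  have hv0 : 0 < v.length := by
    rw [List.length_pos_iff]; rintro rfl; simp at h0
  have := hv.drop (n := u.length) (by simp; omega) (by
    rw [← cat_wrep, cat_append, cat_of_ge le_rfl, Nat.sub_self, SignedShift.cat_zero h0])
  simpa using this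

/-! ### Borders of periodic maximal sequences -/

/-- The first `r` letters of `x` coincide with the last `r` letters of its first period `p`. -/
def IsBorder (x : ℕ → Fin (N + 1)) (p r : ℕ) : Prop :=
  0 < r ∧ r < p ∧ ∀ k < r, x (p - r + k) = x k

/-- `x` has period `p`, none of its proper shifts exceeds `x`, and `p` is minimal. -/
structure IsTop (O : Fin (N + 1) → ℤˣ) (x : ℕ → Fin (N + 1)) (p : ℕ) : Prop where
  period : shift p x = x
  le : ∀ n, SeqLE O (shift n x) x
  minimal : ∀ r, 0 < r → r < p → shift r x ≠ x

theorem IsBorder.shift_eq {x : ℕ → Fin (N + 1)} {p r : ℕ} (h : IsBorder x p r)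
    (hp : shift p x = x) : shift (p - r) x = cat (pre x r) x := by
  have := eq_cat_shift (u := pre x r) (x := shift (p - r) x) (y := x) fun k hk => by
    rw [length_pre] at hk
    rw [cat_pre_of_lt hk, shift, Nat.add_comm k]
    exact h.2.2 k hk
  rwa [length_pre, shift_add, Nat.add_sub_cancel' h.2.1.le, hp] at this

/-- Borders of minimal periods are negative: a positive border would be a smaller period. -/
theorem IsTop.sgn_border {x : ℕ → Fin (N + 1)} {p r : ℕ} (hx : IsTop O x p)
    (h : IsBorder x p r) : sgn O (pre x r) = -1 := by
  refine (sgn_eq_one_or _).resolve_left fun hpos => ?_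
  have h1 := hx.le (p - r)
  rw [h.shift_eq hx.period] at h1
  conv at h1 => rhs; rw [← cat_pre_shift x r]
  exact hx.minimal r h.1 h.2.1 ((hx.le r).antisymm (h1.of_cat_pos hpos))

theorem IsTop.ltb_of_not_border {x : ℕ → Fin (N + 1)} {p r : ℕ} (hx : IsTop O x p)
    (h0 : 0 < r) (hr : r < p) (h : ¬ IsBorder x p r) : LTb O r (shift (p - r) x) x := by
  refine ((hx.le (p - r)).ltb_or_agree r).resolve_right fun h' => h ⟨h0, hr, fun k hk => ?_⟩
  rw [← h' k hk, shift, Nat.add_comm k]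

theorem IsTop.shift_ltb {x : ℕ → Fin (N + 1)} {p r : ℕ} (hx : IsTop O x p)
    (h0 : 0 < r) (hr : r < p) : LTb O p (shift r x) x := by
  refine ((hx.le r).ltb_or_agree p).resolve_right fun h' => hx.minimal r h0 hr ?_
  have key : ∀ k, x (k % p) = x k := fun k => by
    have := congrFun (shift_mod_of_shift hx.period k) 0
    simpa [shift] using this
  have hp : shift p (shift r x) = shift r x := by
    rw [shift_add, Nat.add_comm p r, ← shift_add, hx.period]
  funext k
  have h1 := congrFun (shift_mod_of_shift hp k) 0
  simp only [shift_apply_zero] at h1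
  rw [← h1, h' _ (Nat.mod_lt _ (by omega)), key]

/-- The tail that follows a border grows with the length of the border. -/
theorem IsTop.shift_mono {x : ℕ → Fin (N + 1)} {p r s : ℕ} (hx : IsTop O x p)
    (hr : IsBorder x p r) (hs : IsBorder x p s) (hrs : r ≤ s) :
    SeqLE O (shift r x) (shift s x) := by
  have h1 := hx.le (s - r)
  have h2 : shift (s - r) x = cat (pre x r) (shift s x) := by
    have := eq_cat_shift (u := pre x r) (x := shift (s - r) x) (y := x) fun k hk => by
      rw [length_pre] at hk
      rw [cat_pre_of_lt hk, shift, ← hr.2.2 k hk, ← hs.2.2 (k + (s - r)) (by omega)]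
      congr 1
      have := hs.2.1
      omega
    rwa [length_pre, shift_add, Nat.add_sub_cancel' hrs] at this
  rw [h2] at h1
  conv at h1 => rhs; rw [← cat_pre_shift x r]
  exact h1.of_cat_neg (hx.sgn_border hr)

theorem IsExtremal.isTop {w : List (Fin (N + 1))} (h : IsExtremal Γ O w)
    (hi : IsIrreducibleWord w) : IsTop O (wrep w) w.length :=
  ⟨shift_length_wrep w, h.2.2.2, fun _ h0 hr => hi.shift_ne h0 hr⟩

/-- A periodic word all of whose proper rotations are smaller is extremal and irreducible. -/
theorem isExtremal_of_strict {w : List (Fin (N + 1))} (hw : IsPeriodicWord Γ w)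
    (h : ∀ j, 0 < j → j < w.length → SeqLT O (shift j (wrep w)) (wrep w)) :
    IsExtremal Γ O w ∧ IsIrreducibleWord w := by
  have hl := hw.length_pos
  refine ⟨⟨hw, hw.2, hw.wrep_zero, fun n => ?_⟩, ?_⟩
  · rw [← shift_mod_of_shift (shift_length_wrep w) n]
    rcases Nat.eq_zero_or_pos (n % w.length) with h0 | h0
    · rw [h0]; exact SeqLE.refl _
    · exact Or.inl (h _ h0 (Nat.mod_lt _ hl))
  · rintro ⟨u, k, hk, rfl⟩
    have hu : u ≠ [] := by
      rintro rfl
      exact hw.ne_nil (by simp [SignedShift.wpow])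
    have hul := List.length_pos_iff.2 hu
    have := h u.length hul (by rw [length_wpow]; nlinarith)
    rw [wrep_wpow hu (by omega), shift_length_wrep] at this
    obtain ⟨n, this⟩ := seqLT_iff.1 this
    exact this.irrefl

/-- The border of a maximal sequence is itself a strictly maximal word. -/
theorem IsTop.border_strict {x : ℕ → Fin (N + 1)} {p r : ℕ} (hx : IsTop O x p)
    (hr : IsBorder x p r) (j : ℕ) (h0 : 0 < j) (hj : j < r) :
    SeqLT O (shift j (wrep (pre x r))) (wrep (pre x r)) := by
  have hxr : ∀ k < r, wrep (pre x r) k = x k := fun k hk => by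
    rw [← cat_wrep, cat_pre_of_lt hk]
  -- a tail of the border is a tail of a period, so it is smaller or again a border
  have tail : ∀ i, 0 < i → i < r → ¬ IsBorder x p (r - i) →
      LTb O (r - i) (shift i (wrep (pre x r))) (wrep (pre x r)) := by
    intro i hi0 hir hnb
    have h1 := hx.ltb_of_not_border (r := r - i) (by omega) (by have := hr.2.1; omega) hnb
    refine h1.congr (fun k hk => ?_) fun k hk => (hxr k (by omega)).symm
    rw [shift, shift, hxr _ (by omega), ← hr.2.2 (k + i) (by omega)]
    congr 1
    have := hr.2.1
    omega
  by_cases hb : IsBorder x p (r - j)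
  · have hneg := hx.sgn_border hb
    have e1 : shift j (wrep (pre x r)) = cat (pre x (r - j)) (wrep (pre x r)) := by
      have := eq_cat_shift (u := pre x (r - j)) (x := shift j (wrep (pre x r))) (y := x)
        fun k hk => by
          rw [length_pre] at hk
          rw [cat_pre_of_lt hk, shift, hxr _ (by omega), ← hb.2.2 k hk, ← hr.2.2 _ (by omega)]
          congr 1
          have := hr.2.1
          omega
      have hlen := shift_length_wrep (pre x r)
      rw [length_pre] at hlen
      rwa [length_pre, shift_add, Nat.sub_add_cancel hj.le, hlen] at this
    have e2 : wrep (pre x r) = cat (pre x (r - j)) (shift (r - j) (wrep (pre x r))) := by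
      have := eq_cat_shift (u := pre x (r - j)) (x := wrep (pre x r)) (y := x) fun k hk => by
          rw [length_pre] at hk
          rw [cat_pre_of_lt hk, hxr _ (by omega)]
      rwa [length_pre] at this
    by_cases hb' : IsBorder x p j
    · -- both parts of the border would be negative, and so the border positive
      exfalso
      have h1 := hx.sgn_border hr
      rw [sgn_pre, ← Nat.sub_add_cancel hj.le, psgn_add, ← sgn_pre, hneg] at h1
      have h2 : psgn O (shift (r - j) x) j = sgn O (pre x j) := by
        rw [sgn_pre]
        refine psgn_congr fun k hk => ?_
        rw [shift, ← hb'.2.2 k hk, ← hr.2.2 _ (by omega)]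
        congr 1
        have := hr.2.1
        omega
      rw [h2, hx.sgn_border hb'] at h1
      exact absurd h1 (by decide)
    · have := tail (r - j) (by omega) (by omega) (by rwa [Nat.sub_sub_self hj.le])
      have h3 := this.cat_neg hneg
      rw [← e2, ← e1] at h3
      exact h3.seqLT
  · exact (tail j h0 hj hb).seqLT

/-! ### Tunability and predecessors of negative words -/

/-- The data extracted from tunability, with the base word `g`: the minimality of `gN` is
expressed through arbitrary continuations, and the alternatives for negative words are
restricted to irreducible ones. -/
structure Base (Γ : Digraph (Fin (N + 1))) (O : Fin (N + 1) → ℤˣ)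
    (g : List (Fin (N + 1))) : Prop where
  periodic : IsPeriodicWord Γ g
  ne_last : ∀ k, 0 < k → k < g.length → wrep g k ≠ Fin.last N
  sgn : sgn O g = -1
  last : IsPeriodicWord Γ [Fin.last N]
  min : ∀ c, IsPeriodicWord Γ c → c.length = g.length + 1 → ∀ y z : ℕ → Fin (N + 1),
    z 0 = Fin.last N → ¬ LTb O (g.length + 1) (cat c y) (cat g z)
  dichotomy : ∀ a, IsExtremal Γ O a → IsIrreducibleWord a → SignedShift.sgn O a = -1 →
    a = g ∨ ∃ b, IsTuningPair Γ O b a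

theorem IsTunable.exists_base (h : IsTunable Γ O) : ∃ g, Base Γ O g := by
  obtain ⟨g, ⟨h1, h2, h3, h4, h5⟩, h6⟩ := h
  refine ⟨g, h1, ?_, h3, h4.1.of_append_right rfl, ?_, ?_⟩
  · intro k hk hkl heq
    rw [← cat_wrep, cat_of_lt hkl] at heq
    obtain ⟨a, l, rfl⟩ := List.exists_cons_of_ne_nil h1.ne_nil
    have ha : a = Fin.last N := by simpa using h1.1
    subst ha
    rw [List.count_cons_self, Nat.add_eq_right, List.count_eq_zero] at h2
    obtain ⟨k, rfl⟩ := Nat.exists_eq_succ_of_ne_zero hk.ne'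
    simp only [Nat.succ_eq_add_one, List.getElem_cons_succ] at heq
    exact h2 (heq ▸ List.getElem_mem _)
  · intro c hc hl y z hz hlt
    have e : cat (g ++ [Fin.last N]) (shift 1 z) = cat g z := by
      rw [cat_append]
      congr 1
      funext k
      cases k <;> simp [cat, shift, hz]
    rcases h5 c ⟨hc, hl⟩ with h | h
    · have := (wordLT_iff (shift 1 z) y).1 h
      rw [e] at this
      exact this.asymm hlt
    · rw [← h, ← e] at hlt
      refine hlt.not_agree fun k hk => ?_
      exact cat_congr_lt (by simpa using hk)
  · intro a ha hi hs
    rcases h6 a ha hi hs with ⟨k, hk, rfl⟩ | ⟨b, hb | hb⟩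
    · left
      rcases Nat.lt_or_ge k 2 with h | h
      · obtain rfl : k = 1 := by
          obtain ⟨j, rfl⟩ := hk
          omega
        simp
      · exact absurd ⟨g, k, h, rfl⟩ hi
    · exact absurd (hb.1.2.symm.trans hs) (by decide)
    · exact Or.inr ⟨b, hb⟩

theorem wrep_eq_cat_of_lt {w : List (Fin (N + 1))} {k : ℕ} (hk : k < w.length)
    (z : ℕ → Fin (N + 1)) : wrep w k = cat w z k := by
  rw [← cat_wrep]; exact cat_congr_lt hk

/-- If `p` is at least `a` and less than `b`, it has the common prefix of `a` and `b`. -/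
theorem agree_of_between {n m : ℕ} (hm : m ≤ n) {a b p : ℕ → Fin (N + 1)}
    (h1 : ¬ LTb O n p a) (h2 : ¬ LTb O n b p) (hab : ∀ k < m, a k = b k) :
    ∀ k < m, p k = a k := by
  rcases LTb.trichotomy O m p a with h | h | h
  · exact absurd (h.mono hm) h1
  · exact h
  · exact absurd ((h.congr hab fun _ _ => rfl).mono hm) h2

/-- A proper suffix of an irreducible extremal word `w`, followed by `Y`, is smaller than `w^∞`
if after each border of `w` the continuation `Y` is larger than that of `w^∞`. -/
theorem suffix_ltb_wrep {w : List (Fin (N + 1))} (hw : IsTop O (wrep w) w.length)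
    {j : ℕ} (h0 : 0 < j) (hj : j < w.length) {M : ℕ} {Y : ℕ → Fin (N + 1)}
    (hY : IsBorder (wrep w) w.length (w.length - j) →
      LTb O M (shift (w.length - j) (wrep w)) Y) :
    LTb O (w.length - j + M) (cat (w.drop j) Y) (wrep w) := by
  have hd : ∀ k < w.length - j, cat (w.drop j) Y k = shift j (wrep w) k := fun k hk => by
    rw [← cat_wrep, shift_cat_drop _ _ hj.le]
    exact cat_congr_lt (by simpa using hk)
  by_cases hb : IsBorder (wrep w) w.length (w.length - j)
  · have e1 : w.drop j = pre (wrep w) (w.length - j) := by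
      refine word_ext (x := Y) (y := Y) (by simp) fun k hk => ?_
      rw [List.length_drop] at hk
      rw [hd k hk, cat_pre_of_lt hk, ← hb.2.2 k hk, shift]
      congr 1
      omega
    have h1 := (hY hb).cat_neg (hw.sgn_border hb)
    rwa [length_pre, cat_pre_shift, ← e1] at h1
  · have h1 := hw.ltb_of_not_border (r := w.length - j) (by omega) (by omega) hb
    rw [Nat.sub_sub_self hj.le] at h1
    exact (h1.congr (fun k hk => (hd k hk).symm) fun _ _ => rfl).mono (by omega)

theorem suffix_ltb {w : List (Fin (N + 1))} (hw : IsTop O (wrep w) w.length)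
    {j : ℕ} (h0 : 0 < j) (hj : j < w.length)
    {Y : ℕ → Fin (N + 1)} (Z : ℕ → Fin (N + 1))
    (hY : IsBorder (wrep w) w.length (w.length - j) →
      LTb O j (shift (w.length - j) (wrep w)) Y) :
    LTb O w.length (cat (w.drop j) Y) (cat w Z) := by
  have h1 := suffix_ltb_wrep hw h0 hj hY
  rw [Nat.sub_add_cancel hj.le] at h1
  exact h1.congr (fun _ _ => rfl) fun k hk => wrep_eq_cat_of_lt hk Z

/-- A proper suffix of an irreducible negative extremal word `w`, followed by `w`, is strictly
smaller than `w`. -/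
theorem suffix_self_ltb {w : List (Fin (N + 1))} (hw : IsTop O (wrep w) w.length)
    (hs : sgn O w = -1) {j : ℕ} (h0 : 0 < j) (hj : j < w.length)
    (Y Z : ℕ → Fin (N + 1)) :
    LTb O w.length (cat (w.drop j) (cat w Y)) (cat w Z) := by
  refine suffix_ltb hw h0 hj Z fun hb => ?_
  have hnb : ¬ IsBorder (wrep w) w.length j := by
    intro hb'
    have h1 := hw.sgn_border hb
    have h2 := hw.sgn_border hb'
    have e : w = pre (wrep w) (w.length - j) ++ pre (wrep w) j := by
      refine word_ext (x := wrep w) (y := wrep w) (by simp; omega) fun k hk => ?_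
      rw [cat_wrep, cat_append]
      rcases lt_or_ge k (w.length - j) with h | h
      · rw [cat_pre_of_lt h]
      · rw [cat_of_ge (by simpa using h), length_pre, cat_pre_of_lt (by omega),
          ← hb'.2.2 (k - (w.length - j)) (by omega), Nat.add_sub_cancel' h]
    rw [e, sgn_append, h1, h2] at hs
    exact absurd hs (by decide)
  exact (hw.ltb_of_not_border h0 hj hnb).congr (fun _ _ => rfl)
    fun k hk => wrep_eq_cat_of_lt (by omega) Y

/-- Let `w` be a negative extremal word and `h` a loop at `N` such that `w h w … w` is again
extremal. Its predecessor, which exists by tunability, differs only in the last factor, and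
since it is admissible, that factor is not smaller than `h w`. -/
theorem Base.exists_between {g : List (Fin (N + 1))} (T : Base Γ O g)
    {w h : List (Fin (N + 1))} (hw : IsExtremal Γ O w) (hi : IsIrreducibleWord w)
    (hs : SignedShift.sgn O w = -1) (hh : IsPeriodicWord Γ h)
    (h1 : ∀ j < h.length, ∀ y z, LTb O w.length (cat (h.drop j) (cat w y)) (cat w z))
    (h2 : ∀ r, IsBorder (wrep w) w.length r → ∀ z,
      LTb O (w.length - r) (shift r (wrep w)) (cat h (cat w z)))
    (h3 : ∃ c, IsPeriodicWord Γ c ∧ c.length = 2 * w.length ∧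
      ∀ y z, LTb O (2 * w.length) (cat w (cat w y)) (cat c z)) :
    ∃ e, IsPeriodicWord Γ e ∧ e.length = w.length ∧
      (∀ y z, LTb O w.length (cat e y) (cat w z)) ∧
      ∀ y z, ¬ LTb O w.length (cat e y) (cat h (cat w z)) := by
  have hT := hw.isTop hi
  have hwp := hw.1
  have hwl := hwp.length_pos
  have hhl := hh.length_pos
  obtain ⟨i, hUs⟩ : ∃ i, SignedShift.sgn O (w ++ (h ++ wpow w i)) = -1 := by
    rcases sgn_eq_one_or (O := O) h with hp | hp
    · exact ⟨0, by simp [sgn_append, hs, hp]⟩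
    · exact ⟨1, by simp [sgn_append, hs, hp]⟩
  obtain ⟨U, hU⟩ : ∃ U, U = w ++ (h ++ wpow w i) := ⟨_, rfl⟩
  rw [← hU] at hUs
  have hUp : IsPeriodicWord Γ U := by
    rw [hU]
    refine hwp.append ?_
    rcases eq_or_ne i 0 with rfl | h0
    · simpa using hh
    · exact hh.append (hwp.wpow h0)
  have hXp : IsPeriodicWord Γ (U ++ (w ++ w)) := hUp.append (hwp.append hwp)
  obtain ⟨X, hX⟩ : ∃ X, X = U ++ (w ++ w) := ⟨_, rfl⟩
  rw [← hX] at hXp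
  have hXs : SignedShift.sgn O X = -1 := by simp [hX, sgn_append, hUs, hs]
  have eX : X = w ++ (h ++ wpow w (i + 2)) := by
    rw [hX, hU, wpow_add, wpow_succ w 1, wpow_one]
    simp only [List.append_assoc]
  have hXl : X.length = w.length + (h.length + (i + 2) * w.length) := by
    rw [eX]; simp
  have eS : wrep X = cat w (cat h (cat (wpow w (i + 2)) (wrep X))) := by
    conv_lhs => rw [← cat_wrep, eX, cat_append, cat_append, ← eX]
  have eS' : cat (wpow w (i + 2)) (wrep X) = cat w (cat (wpow w (i + 1)) (wrep X)) := by
    rw [wpow_succ, cat_append]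
  have hstrict : ∀ j, 0 < j → j < X.length → SeqLT O (shift j (wrep X)) (wrep X) := by
    intro j h0 hj
    rcases lt_or_ge j w.length with hjw | hjw
    · -- the tail starts inside of the first factor
      have := suffix_ltb hT h0 hjw (Y := cat h (cat (wpow w (i + 2)) (wrep X)))
        (cat h (cat (wpow w (i + 2)) (wrep X))) fun hb => by
          have := h2 _ hb (cat (wpow w (i + 1)) (wrep X))
          rwa [← eS', Nat.sub_sub_self hjw.le] at this
      rw [← shift_cat_drop _ _ hjw.le, ← eS] at this
      exact this.seqLT
    obtain ⟨j, rfl⟩ := Nat.exists_eq_add_of_le hjw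
    rw [eS, shift_cat, ← eS]
    rcases lt_or_ge j h.length with hjh | hjh
    · have := h1 j hjh (cat (wpow w (i + 1)) (wrep X)) (cat h (cat (wpow w (i + 2)) (wrep X)))
      rw [← eS', ← shift_cat_drop _ _ hjh.le, ← eS] at this
      exact this.seqLT
    obtain ⟨j, rfl⟩ := Nat.exists_eq_add_of_le hjh
    rw [shift_cat]
    have hjd : j < (i + 2) * w.length := by omega
    obtain ⟨d, s, hd, hs', rfl⟩ : ∃ d s, d < i + 2 ∧ s < w.length ∧ j = d * w.length + s :=
      ⟨j / w.length, j % w.length, Nat.div_lt_of_lt_mul (by rwa [Nat.mul_comm] at hjd),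
        Nat.mod_lt _ hwl, (Nat.div_add_mod' j w.length).symm⟩
    obtain ⟨c, hc⟩ : ∃ c, i + 2 = d + (c + 1) := ⟨i + 1 - d, by omega⟩
    rw [hc, wpow_add, cat_append, ← length_wpow, shift_cat, wpow_succ, cat_append]
    -- every factor `w` is followed by another one
    obtain ⟨Y, hY⟩ : ∃ Y, cat (wpow w c) (wrep X) = cat w Y := by
      cases c with
      | zero => exact ⟨_, by rw [wpow_zero, cat_nil]; exact eS⟩
      | succ c => exact ⟨_, by rw [wpow_succ, cat_append]⟩
    rw [hY]
    rcases Nat.eq_zero_or_pos s with rfl | hs0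
    · have := h1 0 hhl (cat (wpow w (i + 1)) (wrep X)) Y
      rw [List.drop_zero, ← eS'] at this
      have := this.cat_neg hs
      rw [← eS] at this
      exact this.seqLT
    · have := suffix_self_ltb hT hs hs0 hs' Y (cat h (cat (wpow w (i + 2)) (wrep X)))
      rw [← shift_cat_drop _ _ hs'.le, ← eS] at this
      exact this.seqLT
  obtain ⟨hXe, hXi⟩ := isExtremal_of_strict hXp hstrict
  rcases T.dichotomy X hXe hXi hXs with hXg | ⟨P, hP⟩
  · refine absurd ?_ (T.ne_last w.length hwl (by rw [← hXg]; omega))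
    rw [← hXg, eS, cat_of_ge le_rfl, Nat.sub_self, hh.cat_zero]
  obtain ⟨⟨⟨hPp, hPa⟩, -⟩, -, -, ⟨-, ⟨-, hPl⟩, hPX, hnext⟩⟩ := hP
  have hXl' : X.length = U.length + 2 * w.length := by simp [hX]; omega
  obtain ⟨c, hcp, hcl, hc⟩ := h3
  have hPlt : ∀ z, LTb O X.length (cat P z) (cat X z) := fun z => by
    have := (wordLT_iff z z).1 hPX
    rwa [← hPl, min_self] at this
  have hUc : ∀ z, LTb O X.length (cat (U ++ c) z) (cat X z) := fun z => by
    rw [hX, cat_append, cat_append, cat_append, ← hX, hXl']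
    exact (hc z z).cat_neg hUs
  have hPc : ∀ z, ¬ LTb O X.length (cat P z) (cat (U ++ c) z) := fun z hlt => by
    have hl : (U ++ c).length = X.length := by rw [List.length_append, hcl, hXl']
    refine hnext (U ++ c) ⟨hUp.append hcp, by rw [hl, hPl]⟩
      ⟨(wordLT_iff z z).2 ?_, (wordLT_iff z z).2 ?_⟩
    · rwa [hl, ← hPl, min_self]
    · rw [hl, min_self]; exact hUc z
  have hPU : ∀ z, ∀ k < U.length + 1, cat P z k = cat (U ++ c) z k := fun z => by
    refine agree_of_between (by omega) (hPc z) (hPlt z).asymm fun k hk => ?_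
    rw [cat_append, hX, cat_append]
    rcases Nat.lt_succ_iff_lt_or_eq.1 hk with hk | rfl
    · exact cat_congr_lt hk
    · rw [cat_of_ge le_rfl, cat_of_ge le_rfl, Nat.sub_self, hcp.cat_zero,
        (hwp.append hwp).cat_zero]
  obtain ⟨e, he⟩ : ∃ e, P = U ++ e := by
    refine ⟨P.drop U.length, ?_⟩
    conv_lhs => rw [← List.take_append_drop U.length P]
    congr 1
    refine word_ext (x := cat (P.drop U.length) (wrep X)) (y := cat c (wrep X))
      (by rw [List.length_take]; omega) fun k hk => ?_
    rw [List.length_take] at hk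
    rw [← cat_append, List.take_append_drop, ← cat_append]
    exact hPU _ k (by omega)
  have hel : e.length = 2 * w.length := by
    have := congrArg List.length he
    rw [List.length_append] at this
    omega
  have hegt : ∀ z, LTb O (2 * w.length) (cat w (cat w z)) (cat e z) := fun z => by
    have := hPlt z
    rw [he, hX, cat_append, cat_append, ← hX, hXl'] at this
    rw [← cat_append]
    exact this.of_cat_neg hUs
  -- the predecessor is maximal, so its tail `e` starts with `w`
  have htail : SeqLE O (cat e (wrep P)) (wrep P) := by
    have h4 := hPa.2.2 U.length
    have h5 : shift U.length (wrep P) = cat e (wrep P) := by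
      conv_lhs => rw [← cat_wrep, he, cat_append]
      rw [shift_length_cat, ← he]
    rwa [h5] at h4
  have hPw : wrep P = cat w (cat h (cat (wpow w i) (cat e (wrep P)))) := by
    conv_lhs => rw [← cat_wrep, he, hU, cat_append, cat_append, cat_append, ← hU, ← he]
  have hew : ∀ k < w.length, cat e (wrep P) k = cat w (wrep P) k := by
    refine agree_of_between (O := O) le_rfl (fun hlt => ?_) (fun hlt => ?_) (fun _ _ => rfl)
    · exact (hegt (wrep P)).asymm (hlt.congr (fun _ _ => rfl) fun k hk => cat_congr_lt hk)
    · refine htail.not_lt (hlt.congr (fun k hk => ?_) fun _ _ => rfl)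
      rw [hPw]; exact cat_congr_lt hk
  obtain ⟨e', rfl⟩ : ∃ e', e = w ++ e' := by
    refine ⟨e.drop w.length, ?_⟩
    conv_lhs => rw [← List.take_append_drop w.length e]
    congr 1
    refine word_ext (x := cat (e.drop w.length) (wrep P)) (y := wrep P)
      (by rw [List.length_take]; omega) fun k hk => ?_
    rw [List.length_take] at hk
    rw [← cat_append, List.take_append_drop]
    exact hew k (by omega)
  have hel' : e'.length = w.length := by
    rw [List.length_append] at hel; omega
  obtain ⟨R, hR⟩ : ∃ R, cat (wpow w i) (cat (w ++ e') (wrep P)) = cat w R := by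
    cases i with
    | zero => exact ⟨_, by rw [wpow_zero, cat_nil, cat_append]⟩
    | succ c => exact ⟨_, by rw [wpow_succ, cat_append]⟩
  have hge : SeqLE O (cat h (cat w R)) (cat e' (wrep P)) := by
    have h6 : SeqLE O (cat w (cat e' (wrep P))) (cat w (cat h (cat w R))) := by
      rw [← cat_append, ← hR, ← hPw]; exact htail
    exact h6.of_cat_neg hs
  have he0 : e'.head? = some (Fin.last N) := by
    have h7 := hge.zero_le
    rw [hh.cat_zero] at h7
    cases e' with
    | nil => simp at hel'; omega
    | cons a l => simpa [cat, Fin.last_le_iff] using h7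
  refine ⟨e', ?_, hel', fun y z => ?_, fun y z hlt => ?_⟩
  · have : IsPeriodicWord Γ ((U ++ w) ++ e') := by
      rw [List.append_assoc, ← he]; exact hPp
    exact this.of_append_right he0
  · have h8 := hegt y
    rw [cat_append, two_mul] at h8
    exact (h8.of_cat_neg hs).congr (fun _ _ => rfl) fun k hk => cat_congr_lt hk
  · refine hge.not_lt (hlt.congr (fun k hk => cat_congr_lt (by omega)) fun k hk => ?_)
    rw [← cat_append, ← cat_append]
    exact cat_congr_lt (by rw [List.length_append]; omega)

/-! ### The base word is minimal among all paths -/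

theorem Base.isExtremal {g : List (Fin (N + 1))} (T : Base Γ O g) :
    IsExtremal Γ O g ∧ IsIrreducibleWord g := by
  refine isExtremal_of_strict T.periodic fun j h0 hj => ?_
  refine (ltb_of_zero_lt one_pos ?_).seqLT
  rw [shift_apply_zero, T.periodic.wrep_zero]
  exact Fin.lt_last_iff_ne_last.2 (T.ne_last j h0 hj)

theorem cat_wpow_last {k n : ℕ} (hk : k < n) (z : ℕ → Fin (N + 1)) :
    cat (wpow [Fin.last N] n) z k = Fin.last N := by
  induction n generalizing k with
  | zero => omega
  | succ n ih =>
    rw [wpow_succ, cat_append]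
    cases k with
    | zero => rfl
    | succ k =>
      rw [cat_of_ge (by simp)]
      exact ih (by simp; omega)

/-- No path from `N` is smaller than `gN`. Otherwise some loop `h` at `N` that meets `N` only
once is smaller than `g`, and then `g h g … g` has no admissible predecessor. -/
theorem Base.not_ltb {g : List (Fin (N + 1))} (T : Base Γ O g) (hconn : StronglyConnected Γ)
    {z : ℕ → Fin (N + 1)} (hz : z ∈ paths Γ) (hz0 : z 0 = Fin.last N) {y : ℕ → Fin (N + 1)}
    (hy0 : y 0 = Fin.last N) : ¬ LTb O (g.length + 1) z (cat g y) := by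
  rintro ⟨i, hi, hi1, hi2⟩
  have hgl := T.periodic.length_pos
  have hi0 : 0 < i := by
    rcases Nat.eq_zero_or_pos i with rfl | h
    · rw [hz0, T.periodic.cat_zero] at hi2
      simp at hi2
    · exact h
  have him : i < g.length := by
    rcases Nat.lt_succ_iff_lt_or_eq.1 hi with h | rfl
    · exact h
    · have h1 : psgn O z g.length = -1 := by
        rw [psgn_congr hi1, ← T.sgn, ← sgn_pre, pre_cat]
      rw [h1, cat_of_ge le_rfl, Nat.sub_self, hy0] at hi2
      simp only [Units.val_neg, Units.val_one, Fin.val_last] at hi2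
      have := (z g.length).is_le
      omega
  have hg1 : ∀ y : ℕ → Fin (N + 1), cat g y 1 ≠ Fin.last N := fun y => by
    rw [← wrep_eq_cat_of_lt (by omega)]
    exact T.ne_last 1 one_pos (by omega)
  have hg1' : ∀ y : ℕ → Fin (N + 1), ((cat g y 1 : Fin (N + 1)) : ℕ) < N := fun y =>
    Fin.lt_last_iff_ne_last.2 (hg1 y)
  have hO : O (Fin.last N) = 1 := by
    refine (Int.units_eq_one_or _).resolve_right fun hO => ?_
    refine T.min (wpow [Fin.last N] (g.length + 1)) (T.last.wpow (by omega)) (by simp) y y hy0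
      ⟨1, by omega, fun k hk => ?_, ?_⟩
    · obtain rfl : k = 0 := by omega
      rw [cat_wpow_last (by omega), T.periodic.cat_zero]
    · rw [cat_wpow_last (by omega)]
      simp only [psgn, Finset.prod_range_one]
      rw [cat_wpow_last (by omega), hO]
      have := hg1' y
      simp only [Units.val_neg, Units.val_one, Fin.val_last]
      omega
  have hzk : ∀ k, 0 < k → k < i → z k ≠ Fin.last N := fun k h0 hk => by
    rw [hi1 k hk, ← wrep_eq_cat_of_lt (by omega)]
    exact T.ne_last k h0 (by omega)
  have hzi : z i ≠ Fin.last N := by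
    intro h
    have hp : IsPeriodicWord Γ (pre z i) := isPeriodicWord_pre (fun k _ => hz k) hz0 hi0 h
    refine T.min (pre z i ++ wpow [Fin.last N] (g.length + 1 - i))
      (hp.append (T.last.wpow (by omega))) (by simp; omega) z y hy0 ?_
    have h2 : LTb O (i + 1) z (cat g y) := ⟨i, i.lt_succ_self, hi1, hi2⟩
    refine (h2.congr (fun k hk => ?_) fun _ _ => rfl).mono (by omega)
    rw [cat_append]
    rcases Nat.lt_succ_iff_lt_or_eq.1 hk with hk | rfl
    · rw [cat_pre_of_lt hk]
    · rw [cat_of_ge (by simp), length_pre, Nat.sub_self, cat_wpow_last (by omega), h]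
  -- the first return to `N` of a path that follows `z` up to position `i`
  obtain ⟨n, p, hp0, hpn, hp⟩ := hconn (z i) (Fin.last N)
  classical
  have hex : ∃ t, p t = Fin.last N := ⟨n, hpn⟩
  obtain ⟨t, ht, htmin⟩ : ∃ t, p t = Fin.last N ∧ ∀ s < t, p s ≠ Fin.last N :=
    ⟨Nat.find hex, Nat.find_spec hex, fun s hs => Nat.find_min hex hs⟩
  have htn : t ≤ n := by
    by_contra h
    exact htmin n (by omega) hpn
  have ht0 : 0 < t := by
    rcases Nat.eq_zero_or_pos t with rfl | h
    · exact absurd (hp0.symm.trans ht) hzi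
    · exact h
  set Z := cat (pre z i) p with hZ
  have hZz : ∀ k < i + 1, Z k = z k := fun k hk => by
    rcases Nat.lt_succ_iff_lt_or_eq.1 hk with hk | rfl
    · rw [hZ, cat_pre_of_lt hk]
    · rw [hZ, cat_of_ge (by simp), length_pre, Nat.sub_self, hp0]
  have hZp : ∀ s, Z (i + s) = p s := fun s => by
    have := cat_add (pre z i) p s
    rwa [length_pre] at this
  have hZadj : ∀ k < i + t, Γ.Adj (Z k) (Z (k + 1)) := fun k hk => by
    rcases lt_or_ge k i with h | h
    · rw [hZz k (by omega), hZz (k + 1) (by omega)]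
      exact hz k
    · obtain ⟨s, rfl⟩ := Nat.exists_eq_add_of_le h
      rw [Nat.add_assoc, hZp, hZp]
      exact hp s (by omega)
  have hZ0 : Z 0 = Fin.last N := by rw [hZz 0 (by omega), hz0]
  have hZne : ∀ k, 0 < k → k < i + t → Z k ≠ Fin.last N := fun k h0 hk => by
    rcases lt_or_ge k i with h | h
    · rw [hZz k (by omega)]
      exact hzk k h0 h
    · obtain ⟨s, rfl⟩ := Nat.exists_eq_add_of_le h
      rw [hZp]
      exact htmin s (by omega)
  have hh : IsPeriodicWord Γ (pre Z (i + t)) :=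
    isPeriodicWord_pre hZadj hZ0 (by omega) (by rw [hZp, ht])
  have hlt : ∀ x w : ℕ → Fin (N + 1), LTb O g.length (cat (pre Z (i + t)) x) (cat g w) := by
    intro x w
    have h2 : LTb O (i + 1) z (cat g y) := ⟨i, i.lt_succ_self, hi1, hi2⟩
    refine (h2.congr (fun k hk => ?_) fun k hk => cat_congr_lt (by omega)).mono (by omega)
    rw [cat_pre_of_lt (by omega), hZz k hk]
  obtain ⟨hge, hgi⟩ := T.isExtremal
  obtain ⟨e, hep, hel, he, -⟩ := T.exists_between hge hgi T.sgn hh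
    (fun j hj x w => by
      rw [length_pre] at hj
      rcases Nat.eq_zero_or_pos j with rfl | h0
      · exact hlt _ _
      · refine ltb_of_zero_lt hgl ?_
        rw [T.periodic.cat_zero, ← shift_cat_drop _ _ (by simpa using hj.le), shift_apply_zero,
          cat_pre_of_lt hj]
        exact Fin.lt_last_iff_ne_last.2 (hZne j h0 hj))
    (fun r hb x => by
      have := hb.2.2 0 hb.1
      rw [T.periodic.wrep_zero, add_zero] at this
      exact absurd this (T.ne_last _ (by have := hb.2.1; omega) (by have := hb.1; omega)))
    ⟨wpow [Fin.last N] (2 * g.length), T.last.wpow (by omega), by simp, fun x w => by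
      refine ⟨1, by omega, fun k hk => ?_, ?_⟩
      · obtain rfl : k = 0 := by omega
        rw [cat_wpow_last (by omega), T.periodic.cat_zero]
      · rw [cat_wpow_last (by omega)]
        simp only [psgn, Finset.prod_range_one]
        rw [T.periodic.cat_zero, hO]
        have := hg1' (cat g x)
        simp only [Units.val_one, Fin.val_last]
        omega⟩
  refine T.min (e ++ [Fin.last N]) (hep.append T.last) (by simp [hel]) y y hy0 ?_
  rw [cat_append]
  exact (he _ _).mono (by omega)

/-- An admissible sequence is `g^∞` or strictly larger than `gN`. -/
theorem Base.eq_or_ltb {g : List (Fin (N + 1))} (T : Base Γ O g) (hconn : StronglyConnected Γ)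
    {x : ℕ → Fin (N + 1)} (hx : SeqAdmissible Γ O x) :
    x = wrep g ∨ ∀ y : ℕ → Fin (N + 1), y 0 = Fin.last N → LTb O (g.length + 1) (cat g y) x := by
  have hgl := T.periodic.length_pos
  -- a tail that starts with `N` is at least `gN`; if `x` starts with `gN`, it is at most `gN`
  by_cases hag : ∀ k < g.length + 1, x k = cat g (wrep g) k
  · left
    have key : ∀ n, shift (n * g.length) x 0 = Fin.last N ∧
        SeqLE O (shift (n * g.length) x) x →
        shift (n * g.length) x = cat g (shift ((n + 1) * g.length) x) ∧
        shift ((n + 1) * g.length) x 0 = Fin.last N := by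
      rintro n ⟨h0, hle⟩
      have h1 : ∀ k < g.length + 1, shift (n * g.length) x k = cat g (wrep g) k := by
        refine agree_of_between (O := O) le_rfl
          (T.not_ltb hconn (shift_mem_paths hx.1 _) h0 T.periodic.wrep_zero) (fun hlt => ?_)
          fun _ _ => rfl
        exact hle.not_lt (hlt.congr (fun k hk => (hag k hk).symm) fun _ _ => rfl)
      constructor
      · have := eq_cat_shift (u := g) (x := shift (n * g.length) x) (y := wrep g)
          fun k hk => h1 k (by omega)
        rwa [shift_add, show g.length + n * g.length = (n + 1) * g.length by ring] at this
      · have := h1 g.length (by omega)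
        rw [cat_of_ge le_rfl, Nat.sub_self, T.periodic.wrep_zero] at this
        rw [shift_apply_zero, Nat.succ_mul, Nat.add_comm (n * g.length), ← this, shift]
    have hall : ∀ n, shift (n * g.length) x 0 = Fin.last N := by
      intro n
      induction n with
      | zero => simpa using hx.2.1
      | succ n ih => exact (key n ⟨ih, hx.2.2 _⟩).2
    have hcat : ∀ n, cat (wpow g n) (shift (n * g.length) x) = x := by
      intro n
      induction n with
      | zero => simp
      | succ n ih =>
        rw [wpow_add, wpow_one, cat_append, ← (key n ⟨hall n, hx.2.2 _⟩).1, ih]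
    funext k
    have hk : k < (wpow g (k + 1)).length := by
      rw [length_wpow]; nlinarith
    rw [← hcat (k + 1), ← cat_wpow_of_cat (cat_wrep g) (k + 1)]
    exact cat_congr_lt hk
  · right
    intro y hy
    rcases LTb.trichotomy O (g.length + 1) (cat g y) x with h | h | h
    · exact h
    · refine absurd (fun k hk => ?_) hag
      rw [← h k hk]
      rcases Nat.lt_succ_iff_lt_or_eq.1 hk with hk | rfl
      · exact cat_congr_lt hk
      · rw [cat_of_ge le_rfl, cat_of_ge le_rfl, Nat.sub_self, hy, T.periodic.wrep_zero]
    · exact absurd h (T.not_ltb hconn hx.1 hx.2.1 hy)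

/-! ### Tuning windows -/

/-- `x` lies in the interval from `w'^∞` to `w' w^∞`, which contains the sequences obtained
by tuning with the pair `(w, w')`. -/
def InWindow (O : Fin (N + 1) → ℤˣ) (w w' : List (Fin (N + 1))) (x : ℕ → Fin (N + 1)) : Prop :=
  SeqLE O (wrep w') x ∧ SeqLE O x (cat w' (wrep w))

theorem IsTuningPair.length_eq {w w' : List (Fin (N + 1))} (h : IsTuningPair Γ O w w') :
    w'.length = w.length := h.2.2.2.2.1.2

theorem IsTuningPair.ltb {w w' : List (Fin (N + 1))} (h : IsTuningPair Γ O w w')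
    (y z : ℕ → Fin (N + 1)) : LTb O w.length (cat w y) (cat w' z) := by
  have := (wordLT_iff y z).1 h.2.2.2.2.2.1
  rwa [h.length_eq, min_self] at this

theorem IsTuningPair.wrep_ltb {w w' : List (Fin (N + 1))} (h : IsTuningPair Γ O w w') :
    LTb O w.length (wrep w) (wrep w') := by
  rw [← cat_wrep w, ← cat_wrep w']; exact h.ltb _ _

theorem IsTuningPair.not_between {w w' c : List (Fin (N + 1))} (h : IsTuningPair Γ O w w')
    (hc : IsPeriodicWord Γ c) (hcl : c.length = w.length) {x y z t : ℕ → Fin (N + 1)}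
    (h1 : LTb O w.length (cat c y) (cat w' z)) : ¬ LTb O w.length (cat w x) (cat c t) := by
  intro h2
  refine h.2.2.2.2.2.2 c ⟨hc, hcl⟩ ⟨(wordLT_iff x t).2 ?_, (wordLT_iff y z).2 ?_⟩
  · rwa [hcl, min_self]
  · rwa [hcl, h.length_eq, min_self]

theorem IsTuningPair.wrep_le_tip {w w' : List (Fin (N + 1))} (h : IsTuningPair Γ O w w') :
    SeqLE O (wrep w') (cat w' (wrep w)) := by
  conv_lhs => rw [← cat_wrep]
  exact h.wrep_ltb.le.cat_neg h.2.2.1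

/-- A sequence of the window starts with `w'`. -/
theorem InWindow.agree {w w' : List (Fin (N + 1))} {x : ℕ → Fin (N + 1)}
    (h : InWindow O w w' x) : ∀ k < w'.length, x k = wrep w' k := by
  refine agree_of_between le_rfl h.1.not_lt h.2.not_lt fun k hk => ?_
  exact wrep_eq_cat_of_lt hk _

theorem InWindow.eq_cat {w w' : List (Fin (N + 1))} {x : ℕ → Fin (N + 1)}
    (h : InWindow O w w' x) : x = cat w' (shift w'.length x) :=
  eq_cat_shift (y := wrep w') fun k hk => by rw [h.agree k hk, cat_wrep]

theorem psgn_shift_period {x : ℕ → Fin (N + 1)} {p : ℕ} (hp : shift p x = x) (r : ℕ) :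
    psgn O (shift r x) p = psgn O x p := by
  have h1 := psgn_add (O := O) x r p
  rw [Nat.add_comm r p, psgn_add, hp, mul_comm] at h1
  exact (mul_left_cancel h1).symm

theorem psgn_wrep (w : List (Fin (N + 1))) : psgn O (wrep w) w.length = sgn O w := by
  rw [← sgn_pre]
  conv_lhs => rw [← cat_wrep, pre_cat]

/-- After a negative prefix of length `t`, the word `w'` continues below `w`: the rotation of
`w'` is smaller than its predecessor `w`, and the first difference cannot come late since the
suffixes of `w` are smaller than `w'`. -/
theorem IsTuningPair.shift_ltb {w w' : List (Fin (N + 1))} (h : IsTuningPair Γ O w w')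
    (hi : IsIrreducibleWord w') {t : ℕ} (h0 : 0 < t) (ht : t < w.length)
    (hs : sgn O (pre (wrep w') t) = -1) :
    LTb O (w.length - t) (shift t (wrep w')) (wrep w) := by
  have hl := h.length_eq
  have hT := h.2.1.isTop hi
  rw [hl] at hT
  have hp' := hT.period
  have hp := shift_length_wrep w
  by_cases hN : wrep w' t = Fin.last N
  swap
  · refine ltb_of_zero_lt (by omega) ?_
    rw [shift_apply_zero, h.1.1.1.wrep_zero]
    exact Fin.lt_last_iff_ne_last.2 hN
  have hc : IsPeriodicWord Γ (pre (shift t (wrep w')) w.length) := by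
    refine isPeriodicWord_pre (fun k _ => shift_mem_paths h.2.1.1.2 t k)
      (by rw [shift_apply_zero, hN]) (by omega) ?_
    have : shift w.length (shift t (wrep w')) = shift t (wrep w') := by
      rw [shift_add, Nat.add_comm w.length t, ← shift_add, hp']
    have := congrFun this 0
    rwa [shift_apply_zero, shift_apply_zero, hN] at this
  have h1 : LTb O w.length (shift t (wrep w')) (wrep w) := by
    rcases LTb.trichotomy O w.length (shift t (wrep w')) (wrep w) with h1 | h1 | h1
    · exact h1
    · exfalso
      have h2 := psgn_congr (O := O) h1
      rw [psgn_shift_period hp', psgn_wrep, ← hl, psgn_wrep, h.2.2.1, h.1.2] at h2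
      exact absurd h2 (by decide)
    · refine absurd ?_ (h.not_between (x := wrep w) (t := wrep w) (y := wrep w)
        (z := wrep w') hc (by simp) ?_)
      · rw [cat_wrep]
        exact h1.congr (fun _ _ => rfl) fun k hk => (cat_pre_of_lt hk).symm
      · rw [cat_wrep]
        exact (hT.shift_ltb h0 ht).congr (fun k hk => (cat_pre_of_lt hk).symm) fun _ _ => rfl
  rcases LTb.trichotomy O (w.length - t) (shift t (wrep w')) (wrep w) with h2 | h2 | h2
  · exact h2
  · exfalso
    set u := pre (wrep w) (w.length - t) with hu
    have e1 : wrep w = cat u (shift (w.length - t) (wrep w)) := (cat_pre_shift _ _).symm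
    have e2 : shift t (wrep w') = cat u (wrep w') := by
      have := eq_cat_shift (u := u) (x := shift t (wrep w')) (y := wrep w) fun k hk => by
        rw [hu, length_pre] at hk
        rw [h2 k hk, hu, cat_pre_of_lt hk]
      rwa [hu, length_pre, shift_add, Nat.sub_add_cancel ht.le, hp'] at this
    have hsu : sgn O u = 1 := by
      have h3 : psgn O (wrep w') (t + (w.length - t)) = -1 := by
        rw [Nat.add_sub_cancel' ht.le, ← hl, psgn_wrep, h.2.2.1]
      rw [psgn_add, ← sgn_pre, hs, psgn_congr h2, ← sgn_pre, ← hu] at h3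
      simpa using h3
    have hul : u.length = w.length - t := by simp [hu]
    rw [e2, e1, show w.length = u.length + t by omega] at h1
    have h4 := h1.of_cat_pos hsu
    rw [Nat.add_sub_cancel] at h4
    exact (h4.trans_le (h.1.1.2.2.2 u.length)).asymm h.wrep_ltb
  · exact absurd (h2.mono (m := w.length) (by omega)) h1.asymm

/-- In a periodic admissible sequence of the window, every tail that starts with a word between
`w` and `w'` starts with one of them. Otherwise let `h` be the part of the tail before the next
occurrence of `w'`: then `w' h w' … w'` has no admissible predecessor. -/
theorem Base.starts_with {g : List (Fin (N + 1))} (T : Base Γ O g)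
    {w w' : List (Fin (N + 1))} (h : IsTuningPair Γ O w w') (hi : IsIrreducibleWord w')
    {x : ℕ → Fin (N + 1)} (hx : SeqAdmissible Γ O x) {p : ℕ} (hp0 : 0 < p) (hp : shift p x = x)
    (hw : InWindow O w w' x) {n : ℕ} (hn : SeqLE O (wrep w) (shift n x)) :
    (∀ k < w.length, shift n x k = wrep w k) ∨ (∀ k < w.length, shift n x k = wrep w' k) := by
  by_contra hcon
  push Not at hcon
  obtain ⟨hne, hne'⟩ := hcon
  have hl := h.length_eq
  have hT := h.2.1.isTop hi
  have hxw := hw.agree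
  rw [hl] at hT hxw
  have hwl := h.1.1.1.length_pos
  set y := shift n x with hy
  have hlow : LTb O w.length (wrep w) y := by
    refine (hn.ltb_or_agree w.length).resolve_right fun h' => ?_
    obtain ⟨k, hk, hk'⟩ := hne
    exact hk' (h' k hk).symm
  have htail : ∀ m, (∃ k < w.length, shift m x k ≠ wrep w' k) →
      LTb O w.length (shift m x) (wrep w') := by
    intro m hm
    have := ((hx.2.2 m).ltb_or_agree w.length).resolve_right fun h' => by
      obtain ⟨k, hk, hk'⟩ := hm
      exact hk' (by rw [h' k hk, hxw k hk])
    exact this.congr (fun _ _ => rfl) hxw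
  have hup : LTb O w.length y (wrep w') := htail n hne'
  have hy0 : y 0 = Fin.last N := by
    have := hn.zero_le
    rwa [h.1.1.1.wrep_zero, Fin.last_le_iff] at this
  have hyp : y ∈ paths Γ := shift_mem_paths hx.1 n
  classical
  have hex : ∃ j, 0 < j ∧ ∀ k < w.length, shift j y k = wrep w' k := by
    obtain ⟨j, hj⟩ : ∃ j, (n + 1) * p = n + j :=
      ⟨(n + 1) * p - n, by rw [Nat.add_sub_cancel']; nlinarith⟩
    have hj0 : 0 < j := by
      rcases Nat.eq_zero_or_pos j with rfl | h
      · nlinarith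
      · exact h
    refine ⟨j, hj0, fun k hk => ?_⟩
    rw [hy, shift_add, Nat.add_comm j n, ← hj, shift_mul_of_shift hp]
    exact hxw k hk
  obtain ⟨j, ⟨hj0, hj⟩, hjmin⟩ : ∃ j, (0 < j ∧ ∀ k < w.length, shift j y k = wrep w' k) ∧
      ∀ i < j, ¬ (0 < i ∧ ∀ k < w.length, shift i y k = wrep w' k) :=
    ⟨Nat.find hex, Nat.find_spec hex, fun i hi => Nat.find_min hex hi⟩
  have hyj : y j = Fin.last N := by
    have := hj 0 hwl
    rwa [shift_apply_zero, h.2.1.1.wrep_zero] at this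
  have hh : IsPeriodicWord Γ (pre y j) := isPeriodicWord_pre (fun k _ => hyp k) hy0 hj0 hyj
  have hag : ∀ i ≤ j, ∀ z : ℕ → Fin (N + 1), ∀ k < w.length,
      cat ((pre y j).drop i) (cat w' z) k = shift i y k := by
    intro i hi z k hk
    rw [← shift_cat_drop _ _ (by simpa using hi), shift, shift]
    rcases lt_or_ge (k + i) j with h1 | h1
    · rw [cat_pre_of_lt h1]
    · rw [cat_of_ge (by simpa using h1), length_pre, ← wrep_eq_cat_of_lt (by omega),
        ← hj _ (by omega), shift]
      congr 1
      omega
  obtain ⟨e, hep, hel, he, hne⟩ := T.exists_between h.2.1 hi h.2.2.1 hh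
    (fun i hi u v => by
      rw [length_pre] at hi
      rw [hl]
      have h1 : LTb O w.length (shift i y) (wrep w') := by
        rcases Nat.eq_zero_or_pos i with rfl | h0
        · exact hup
        · have h2 := hjmin i hi
          push Not at h2
          rw [hy, shift_add]
          refine htail _ ?_
          have := h2 h0
          rwa [hy, shift_add] at this
      exact h1.congr (fun k hk => (hag i hi.le u k hk).symm)
        fun k hk => wrep_eq_cat_of_lt (by omega) v)
    (fun r hb z => by
      rw [hl] at hb ⊢
      have h1 := h.shift_ltb hi hb.1 hb.2.1 (hT.sgn_border hb)
      refine (h1.trans_le hn).congr (fun _ _ => rfl) fun k hk => ?_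
      have := hag 0 (Nat.zero_le _) z k (by omega)
      rw [List.drop_zero, shift_zero] at this
      exact this.symm)
    ⟨w' ++ w, h.2.1.1.append h.1.1.1, by rw [List.length_append]; omega, fun u v => by
      rw [cat_append, two_mul]
      conv in w'.length => rw [hl]
      have := (h.ltb v u).cat_neg h.2.2.1
      rw [hl] at this
      simpa [hl] using this⟩
  rw [hl] at hel he hne
  have h5 := h.not_between (x := wrep w) (t := wrep w) hep hel (he (wrep w) (wrep w))
  refine hne (wrep w) (wrep w) ?_
  have h6 : LTb O w.length (wrep w) (cat (pre y j) (cat w' (wrep w))) :=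
    hlow.congr (fun _ _ => rfl) fun k hk => by
      have := hag 0 (Nat.zero_le _) (wrep w) k hk
      rw [List.drop_zero, shift_zero] at this
      exact this.symm
  rw [cat_wrep] at h5
  rcases LTb.trichotomy O w.length (cat e (wrep w)) (wrep w) with h7 | h7 | h7
  · exact (h7.trans h6).mono (by simp)
  · exact h6.congr (fun k hk => (h7 k hk).symm) fun _ _ => rfl
  · exact absurd h7 h5

/-- The word that tuning substitutes for a letter. -/
def block (w w' : List (Fin (N + 1))) (i : Fin (1 + 1)) : List (Fin (N + 1)) :=
  if i = 0 then w else w'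

/-- `x` is the concatenation of the words that tuning substitutes for the letters of `V`. -/
def IsBlocks (w w' : List (Fin (N + 1))) (V : ℕ → Fin (1 + 1)) (x : ℕ → Fin (N + 1)) : Prop :=
  ∀ k, shift (k * w.length) x = cat (block w w' (V k)) (shift ((k + 1) * w.length) x)

theorem Base.exists_isBlocks {g : List (Fin (N + 1))} (T : Base Γ O g)
    {w w' : List (Fin (N + 1))} (h : IsTuningPair Γ O w w') (hi : IsIrreducibleWord w')
    {x : ℕ → Fin (N + 1)} (hx : SeqAdmissible Γ O x) {p : ℕ} (hp0 : 0 < p) (hp : shift p x = x)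
    (hw : InWindow O w w' x) : ∃ V, IsBlocks w w' V x := by
  have hl := h.length_eq
  have step : ∀ k, SeqLE O (wrep w) (shift (k * w.length) x) →
      (shift (k * w.length) x = cat w (shift ((k + 1) * w.length) x) ∨
        shift (k * w.length) x = cat w' (shift ((k + 1) * w.length) x)) := by
    intro k hk
    rcases T.starts_with h hi hx hp0 hp hw hk with h1 | h1
    · left
      have := eq_cat_shift (u := w) (y := wrep w) (x := shift (k * w.length) x)
        fun j hj => by rw [h1 j hj, cat_wrep]
      rwa [shift_add, Nat.add_comm w.length, ← Nat.succ_mul] at this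
    · right
      have := eq_cat_shift (u := w') (y := wrep w') (x := shift (k * w.length) x)
        fun j hj => by rw [h1 j (by omega), cat_wrep]
      rwa [hl, shift_add, Nat.add_comm w.length, ← Nat.succ_mul] at this
  have hall : ∀ k, SeqLE O (wrep w) (shift (k * w.length) x) := by
    intro k
    induction k with
    | zero => simpa using h.wrep_ltb.le.trans hw.1
    | succ k ih =>
      rcases step k ih with h1 | h1
      · rw [h1] at ih
        conv at ih => lhs; rw [← cat_wrep]
        exact ih.of_cat_pos h.1.2
      · have h2 := (hx.2.2 (k * w.length)).trans hw.2
        rw [h1] at h2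
        exact h2.of_cat_neg h.2.2.1
  choose V hV using fun k => show ∃ i : Fin (1 + 1), shift (k * w.length) x =
      cat (block w w' i) (shift ((k + 1) * w.length) x) from by
    rcases step k (hall k) with h1 | h1
    · exact ⟨0, by simpa [block] using h1⟩
    · exact ⟨1, by simpa [block] using h1⟩
  exact ⟨V, hV⟩

theorem IsTuningPair.length_block {w w' : List (Fin (N + 1))} (h : IsTuningPair Γ O w w')
    (i : Fin (1 + 1)) : (block w w' i).length = w.length := by
  unfold block; split
  · rfl
  · exact h.length_eq

/-- In a sequence of the window, `w'` occurs only as a factor of the block decomposition. -/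
theorem IsTuningPair.dvd_of_agree {w w' : List (Fin (N + 1))} (h : IsTuningPair Γ O w w')
    (hi : IsIrreducibleWord w') {x : ℕ → Fin (N + 1)} (hx : SeqAdmissible Γ O x)
    (hw : InWindow O w w' x) {V : ℕ → Fin (1 + 1)} (hV : IsBlocks w w' V x) {j : ℕ}
    (hj : ∀ k < w.length, x (j + k) = wrep w' k) : w.length ∣ j := by
  have hl := h.length_eq
  have hT := h.2.1.isTop hi
  rw [hl] at hT
  have hwl := h.1.1.1.length_pos
  rw [Nat.dvd_iff_mod_eq_zero]
  by_contra hs0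
  set c := j / w.length
  set s := j % w.length
  have hjcs : j = c * w.length + s := (Nat.div_add_mod' j w.length).symm
  have hs : s < w.length := Nat.mod_lt _ hwl
  have hs0 : 0 < s := Nat.pos_of_ne_zero hs0
  -- the letters of the blocks number `c` and `c + 1`
  have hb : ∀ d, ∀ k < w.length, x (d * w.length + k) = wrep (block w w' (V d)) k := by
    intro d k hk
    rw [wrep_eq_cat_of_lt (by rw [h.length_block]; exact hk), ← hV d, shift, Nat.add_comm k]
  have h1 : ∀ k < w.length - s, wrep (block w w' (V c)) (s + k) = wrep w' k := fun k hk => by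
    rw [← hb c _ (by omega), ← hj k (by omega), hjcs, Nat.add_assoc]
  have h2 : ∀ k < s, shift (w.length - s) (wrep w') k = wrep (block w w' (V (c + 1))) k :=
    fun k hk => by
      rw [← hb _ _ (by omega), shift, ← hj _ (by omega), hjcs, Nat.succ_mul]
      congr 1
      omega
  have hneg : sgn O (pre (wrep w') (w.length - s)) ≠ -1 := by
    intro hneg
    have h3 := h.shift_ltb hi (by omega) (by omega) hneg
    rw [Nat.sub_sub_self hs.le] at h3
    unfold block at h2
    split at h2
    · exact h3.not_agree h2
    · exact (h3.trans_le h.wrep_ltb.le).not_agree h2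
  have hpos := (sgn_eq_one_or (O := O) (pre (wrep w') (w.length - s))).resolve_right hneg
  unfold block at h1
  split at h1
  · -- a positive suffix of `w` that is a prefix of `w'` makes `w^∞` an upper bound of `x`
    have hag : ∀ k < w.length - s, wrep w k = wrep w' k := by
      have hsh : ∀ k < w.length - s, shift s (wrep w) k = wrep w' k := fun k hk => by
        rw [shift, Nat.add_comm k]; exact h1 k hk
      rcases LTb.trichotomy O (w.length - s) (wrep w) (wrep w') with h3 | h3 | h3
      · exact absurd hsh ((h.1.1.2.2.2 s).trans_ltb h3).not_agree
      · exact h3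
      · exact absurd h3 h.wrep_ltb.asymm
    obtain ⟨t, ht⟩ : ∃ t, t = w.length - s := ⟨_, rfl⟩
    rw [← ht] at hag hpos h1
    obtain ⟨u, hu⟩ : ∃ u, u = pre (wrep w') t := ⟨_, rfl⟩
    have hul : u.length = t := by rw [hu, length_pre]
    have hcu : ∀ (y z : ℕ → Fin (N + 1)), (∀ k < t, y k = wrep w' k) →
        y = cat u (shift t y) := fun y z hy => by
      have := eq_cat_shift (u := u) (x := y) (y := z) fun k hk => by
        rw [hul] at hk
        rw [hu, cat_pre_of_lt hk, hy k hk]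
      rwa [hul] at this
    rw [← hu] at hpos
    have e1 : shift s (wrep w) = cat u (wrep w) := by
      have := hcu (shift s (wrep w)) x fun k hk => by
        rw [shift, Nat.add_comm k]; exact h1 k hk
      rwa [shift_add, ht, Nat.sub_add_cancel hs.le, shift_length_wrep] at this
    have e2 := hcu (wrep w) x hag
    have h4 := h.1.1.2.2.2 s
    rw [e1] at h4
    conv at h4 => rhs; rw [e2]
    have e3 : shift t (wrep w) = wrep w :=
      (h.1.1.2.2.2 t).antisymm (h4.of_cat_pos hpos)
    rw [e3] at e2
    have hxw := hw.agree
    have e4 := hcu x x fun k hk => hxw k (by omega)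
    have h5 : SeqLE O (shift t x) (wrep w) := by
      refine le_of_le_cat (u := u) ?_ e2.symm ?_
      · rw [← List.length_pos_iff]; omega
      · rw [← e4]; exact hx.2.2 t
    have h6 := h5.cat_pos hpos
    rw [← e4, ← e2] at h6
    exact (h6.trans_ltb h.wrep_ltb |>.trans_le hw.1).irrefl
  · refine hneg (hT.sgn_border ⟨by omega, by omega, fun k hk => ?_⟩)
    rw [Nat.sub_sub_self hs.le]
    exact h1 k hk

theorem length_tune {w w' : List (Fin (N + 1))} (hl : w'.length = w.length)
    (v : List (Fin (1 + 1))) : (tune w w' v).length = v.length * w.length := by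
  induction v with
  | nil => simp [tune]
  | cons i v ih =>
    rw [tune, List.flatMap_cons, ← tune, List.length_append, ih, List.length_cons, Nat.succ_mul]
    split <;> omega

theorem tune_append (w w' : List (Fin (N + 1))) (v u : List (Fin (1 + 1))) :
    tune w w' (v ++ u) = tune w w' v ++ tune w w' u := by
  simp [tune]

theorem tune_singleton (w w' : List (Fin (N + 1))) (i : Fin (1 + 1)) :
    tune w w' [i] = block w w' i := by
  simp [tune, block]

theorem IsTuningPair.sgn_tune {w w' : List (Fin (N + 1))} (h : IsTuningPair Γ O w w')
    (v : List (Fin (1 + 1))) : sgn O (tune w w' v) = sgn unimodalSign v := by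
  induction v with
  | nil => rfl
  | cons i v ih =>
    rw [← List.singleton_append, tune_append, sgn_append, sgn_append, ih, tune_singleton]
    congr 1
    fin_cases i
    · simpa [block, sgn, unimodalSign] using h.1.2
    · simpa [block, sgn, unimodalSign] using h.2.2.1

theorem IsBlocks.cat_tune {w w' : List (Fin (N + 1))} {V : ℕ → Fin (1 + 1)}
    {x : ℕ → Fin (N + 1)} (h : IsBlocks w w' V x) (m : ℕ) :
    cat (tune w w' (pre V m)) (shift (m * w.length) x) = x := by
  induction m with
  | zero => simp [pre, tune]
  | succ m ih =>
    have e : pre V (m + 1) = pre V m ++ [V m] := by simp [pre, List.range_succ]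
    rw [e, tune_append, tune_singleton, cat_append, ← h m, ih]

theorem IsBlocks.shift {w w' : List (Fin (N + 1))} {V : ℕ → Fin (1 + 1)}
    {x : ℕ → Fin (N + 1)} (h : IsBlocks w w' V x) (n : ℕ) :
    IsBlocks w w' (SignedShift.shift n V) (SignedShift.shift (n * w.length) x) := by
  intro k
  have := h (k + n)
  rwa [Nat.add_right_comm, Nat.add_mul, Nat.add_mul (k + 1), ← shift_add, ← shift_add] at this

/-- Tuning preserves the order. -/
theorem IsTuningPair.ltb_of_isBlocks {w w' : List (Fin (N + 1))} (h : IsTuningPair Γ O w w')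
    {V V' : ℕ → Fin (1 + 1)} {x x' : ℕ → Fin (N + 1)} (hV : IsBlocks w w' V x)
    (hV' : IsBlocks w w' V' x') {n : ℕ} (hlt : LTb unimodalSign n V V') : SeqLT O x x' := by
  obtain ⟨i, -, h1, h2⟩ := hlt
  have e : pre V i = pre V' i := List.map_congr_left fun k hk => h1 k (List.mem_range.1 hk)
  have hs : sgn O (tune w w' (pre V i)) = psgn unimodalSign V i := by
    rw [h.sgn_tune, sgn_pre]
  have ex := hV.cat_tune i
  have ex' := hV'.cat_tune i
  rw [hV i] at ex
  rw [hV' i, ← e] at ex'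
  rw [← ex, ← ex']
  have hVi := (V i).is_le
  have hVi' := (V' i).is_le
  have b0 : ∀ j : Fin (1 + 1), (j : ℕ) = 0 → block w w' j = w := fun j hj => by
    simp [block, Fin.ext_iff, hj]
  have b1 : ∀ j : Fin (1 + 1), (j : ℕ) = 1 → block w w' j = w' := fun j hj => by
    simp [block, Fin.ext_iff, hj]
  rcases Int.units_eq_one_or (psgn unimodalSign V i) with hu | hu
  · rw [hu] at hs h2
    simp only [Units.val_one] at h2
    rw [b0 _ (by omega), b1 _ (by omega)]
    exact ((h.ltb _ _).cat_pos hs).seqLT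
  · rw [hu] at hs h2
    simp only [Units.val_one, Units.val_neg] at h2
    rw [b1 _ (by omega), b0 _ (by omega)]
    exact ((h.ltb _ _).cat_neg hs).seqLT

/-- An admissible word of the window of a tuning pair is a tuning with this pair. -/
theorem Base.exists_tune {g : List (Fin (N + 1))} (T : Base Γ O g)
    {w w' : List (Fin (N + 1))} (h : IsTuningPair Γ O w w') (hi : IsIrreducibleWord w')
    {a : List (Fin (N + 1))} (ha : IsAdmissible Γ O a) (hw : InWindow O w w' (wrep a)) :
    ∃ v, IsAdmissible unimodalGraph unimodalSign v ∧ a = tune w w' v := by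
  have hl := h.length_eq
  have hwl := h.1.1.1.length_pos
  have hal := ha.1.1.length_pos
  have hx := ha.1.2
  obtain ⟨x, hxa⟩ : ∃ x, x = wrep a := ⟨_, rfl⟩
  have hp := shift_length_wrep a
  have hcat := cat_wrep a
  rw [← hxa] at hw hx hp hcat
  obtain ⟨V, hV⟩ := T.exists_isBlocks h hi hx hal hp hw
  have hxw := hw.agree
  rw [hl] at hxw
  obtain ⟨m, hm⟩ := h.dvd_of_agree hi hx hw hV (j := a.length) fun k hk => by
    rw [← hxw k hk, Nat.add_comm a.length k]
    exact congrFun hp k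
  rw [Nat.mul_comm] at hm
  have hm0 : 0 < m := by
    rcases Nat.eq_zero_or_pos m with rfl | h0
    · omega
    · exact h0
  have ea : a = tune w w' (pre V m) := by
    refine word_ext (x := x) (y := x) (by rw [length_tune hl, length_pre, hm]) fun k _ => ?_
    have := hV.cat_tune m
    rw [← hm, hp] at this
    rw [this, hcat]
  have hVp : shift m V = V := by
    have hs := hV.shift m
    rw [← hm, hp] at hs
    funext k
    by_contra hne
    rcases LTb.trichotomy unimodalSign (k + 1) (shift m V) V with h1 | h1 | h1
    · obtain ⟨n, hn⟩ := seqLT_iff.1 (h.ltb_of_isBlocks hs hV h1)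
      exact hn.irrefl
    · exact hne (h1 k k.lt_succ_self)
    · obtain ⟨n, hn⟩ := seqLT_iff.1 (h.ltb_of_isBlocks hV hs h1)
      exact hn.irrefl
  have hV0 : V 0 = Fin.last 1 := by
    by_contra hne
    have h0 : V 0 = 0 := by
      have := (V 0).is_le
      have h2 : ¬ ((V 0 : ℕ) = 1) := fun h' => hne (Fin.ext h')
      exact Fin.ext (by simp only [Fin.val_zero]; omega)
    have h1 := hV 0
    rw [h0] at h1
    simp only [Nat.zero_mul, shift_zero, block, if_true] at h1
    refine h.wrep_ltb.not_agree fun k hk => ?_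
    rw [← hxw k hk, h1, wrep_eq_cat_of_lt hk]
  have hrep : wrep (pre V m) = V := by
    refine (eq_wrep ?_ ?_).symm
    · rw [← List.length_pos_iff, length_pre]; exact hm0
    · conv_rhs => rw [← cat_pre_shift V m, hVp]
  refine ⟨pre V m, ⟨⟨⟨?_, fun _ => trivial⟩, fun _ => trivial, ?_, fun n => ?_⟩, ?_⟩, ea⟩
  · obtain ⟨k, rfl⟩ := Nat.exists_eq_succ_of_ne_zero hm0.ne'
    simp [pre, List.range_succ_eq_map, hV0]
  · rw [hrep, hV0]
  · rw [hrep]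
    rcases seqLT_or_le unimodalSign V (shift n V) with h1 | h1
    · obtain ⟨i, hi'⟩ := seqLT_iff.1 h1
      obtain ⟨d, hd⟩ := seqLT_iff.1 (h.ltb_of_isBlocks hV (hV.shift n) hi')
      exact absurd hd (hx.2.2 _).not_lt
    · exact h1
  · rw [← h.sgn_tune, ← ea, ha.2]

/-! ### Escaping words -/

/-- `q` escapes from `α`: after a power of `α` it can be followed by any sequence that starts
with `N` without creating a tail of at least `α^∞`. The second condition concerns the tails that
start inside of `q`, the third one those that start inside of the power of `α`. -/
structure Escapes (Γ : Digraph (Fin (N + 1))) (O : Fin (N + 1) → ℤˣ)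
    (α q : List (Fin (N + 1))) : Prop where
  periodic : IsPeriodicWord Γ q
  inner : ∀ j < q.length, ∃ L, ∀ z : ℕ → Fin (N + 1), z 0 = Fin.last N →
    LTb O L (shift j (cat q z)) (wrep α)
  border : ∀ r, IsBorder (wrep α) α.length r → ∃ L, ∀ z : ℕ → Fin (N + 1), z 0 = Fin.last N →
    LTb O L (shift r (wrep α)) (cat q z)

theorem Escapes.wpow_ltb {α q : List (Fin (N + 1))} (h : Escapes Γ O α q)
    (hα : IsAdmissible Γ O α) (i : ℕ) : ∃ L, ∀ z : ℕ → Fin (N + 1), z 0 = Fin.last N →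
    LTb O L (cat (wpow α i) (cat q z)) (wrep α) := by
  obtain ⟨L, hL⟩ := h.inner 0 h.periodic.length_pos
  refine ⟨(wpow α i).length + L, fun z hz => ?_⟩
  have := (hL z hz).cat_pos (u := wpow α i) (by rw [sgn_wpow, hα.2, one_pow])
  rwa [shift_zero, cat_wpow_of_cat (cat_wrep α)] at this

/-- The tails that start inside of a factor `α` are smaller than `α^∞`, uniformly in the number
of factors. -/
theorem Escapes.wpow_shift_ltb {α q : List (Fin (N + 1))} (h : Escapes Γ O α q)
    (hα : IsAdmissible Γ O α) (hi : IsIrreducibleWord α) :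
    ∃ L, ∀ K (z : ℕ → Fin (N + 1)), z 0 = Fin.last N → ∀ j < K * α.length, ¬ α.length ∣ j →
      LTb O L (shift j (cat (wpow α K) (cat q z))) (wrep α) := by
  have hT := hα.1.isTop hi
  have hl := hα.1.1.length_pos
  have hex : ∀ r, ∃ L, IsBorder (wrep α) α.length r → ∀ z : ℕ → Fin (N + 1),
      z 0 = Fin.last N → LTb O L (shift r (wrep α)) (cat q z) := fun r => by
    by_cases hb : IsBorder (wrep α) α.length r
    · obtain ⟨L, hL⟩ := h.border r hb
      exact ⟨L, fun _ => hL⟩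
    · exact ⟨0, fun hb' => absurd hb' hb⟩
  choose L hL using hex
  refine ⟨α.length + (α.length + ∑ r ∈ Finset.range α.length, L r), fun K z hz j hj hjd => ?_⟩
  obtain ⟨d, s, hd, hs, rfl⟩ : ∃ d s, d < K ∧ s < α.length ∧ j = d * α.length + s :=
    ⟨j / α.length, j % α.length, Nat.div_lt_of_lt_mul (by rwa [Nat.mul_comm] at hj),
      Nat.mod_lt _ hl, (Nat.div_add_mod' j α.length).symm⟩
  have hs0 : 0 < s := by
    rcases Nat.eq_zero_or_pos s with rfl | h0
    · exact absurd (Dvd.intro_left d rfl) hjd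
    · exact h0
  obtain ⟨c, rfl⟩ : ∃ c, K = d + (c + 1) := ⟨K - d - 1, by omega⟩
  rw [wpow_add, cat_append, ← length_wpow, shift_cat, wpow_succ, cat_append,
    shift_cat_drop _ _ hs.le]
  refine (suffix_ltb_wrep hT hs0 hs
    (M := α.length + ∑ r ∈ Finset.range α.length, L r) fun hb => ?_).mono (by omega)
  cases c with
  | zero =>
    rw [wpow_zero, cat_nil]
    refine (hL _ hb z hz).mono ?_
    have := Finset.single_le_sum (f := L) (fun _ _ => Nat.zero_le _)
      (Finset.mem_range.2 hb.2.1)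
    omega
  | succ c =>
    rw [wpow_succ, cat_append]
    refine ((hT.shift_ltb hb.1 hb.2.1).congr (fun _ _ => rfl) fun k hk => ?_).mono
      (Nat.le_add_right _ _)
    exact wrep_eq_cat_of_lt hk _

theorem Escapes.append_shift_ltb {α q : List (Fin (N + 1))} (h : Escapes Γ O α q)
    (hα : IsAdmissible Γ O α) (hi : IsIrreducibleWord α) (K : ℕ) {j : ℕ}
    (hj : j < (wpow α K ++ q).length) : ∃ L, ∀ z : ℕ → Fin (N + 1), z 0 = Fin.last N →
      LTb O L (shift j (cat (wpow α K ++ q) z)) (wrep α) := by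
  simp only [cat_append]
  rw [List.length_append] at hj
  rcases lt_or_ge j (wpow α K).length with hjl | hjl
  · by_cases hd : α.length ∣ j
    · obtain ⟨d, rfl⟩ := hd
      rw [length_wpow, Nat.mul_comm K] at hjl
      obtain ⟨c, rfl⟩ := Nat.exists_eq_add_of_lt (Nat.lt_of_mul_lt_mul_left hjl)
      obtain ⟨L, hL⟩ := h.wpow_ltb hα (c + 1)
      refine ⟨L, fun z hz => ?_⟩
      rw [Nat.add_assoc, wpow_add, cat_append, Nat.mul_comm, ← length_wpow, shift_length_cat]
      exact hL z hz
    · obtain ⟨L, hL⟩ := h.wpow_shift_ltb hα hi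
      exact ⟨L, fun z hz => hL K z hz j (by simpa using hjl) hd⟩
  · obtain ⟨s, rfl⟩ := Nat.exists_eq_add_of_le hjl
    obtain ⟨L, hL⟩ := h.inner s (by omega)
    refine ⟨L, fun z hz => ?_⟩
    rw [shift_cat]
    exact hL z hz

/-! ### Nested windows -/

theorem two_le_length_of_admissible {v : List (Fin (1 + 1))}
    (hv : IsAdmissible unimodalGraph unimodalSign v) : 2 ≤ v.length := by
  have h0 := hv.1.1.length_pos
  by_contra hlt
  obtain ⟨i, rfl⟩ := List.length_eq_one_iff.1 (show v.length = 1 by omega)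
  have h1 : i = Fin.last 1 := by simpa using hv.1.1.1
  subst h1
  exact absurd hv.2 (by decide)

theorem Base.length_lt_of_inWindow {g : List (Fin (N + 1))} (T : Base Γ O g)
    {w w₁ w₁' : List (Fin (N + 1))} (hw : IsAdmissible Γ O w) (h₁ : IsTuningPair Γ O w₁ w₁')
    (hi : IsIrreducibleWord w₁') (h : InWindow O w₁ w₁' (wrep w)) : w₁.length < w.length := by
  obtain ⟨v, hv, rfl⟩ := T.exists_tune h₁ hi hw h
  rw [length_tune h₁.length_eq]
  have := two_le_length_of_admissible hv
  have := h₁.1.1.1.length_pos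
  nlinarith

/-- If `w` lies in the window of `(w₁, w₁')` and `X` starts with the successor `w'` of `w`, then
`X` can exceed the end `w₁' w₁^∞` of this window only if `w'` is a prefix of it. -/
theorem Base.exists_tip {g : List (Fin (N + 1))} (T : Base Γ O g)
    {w w' w₁ w₁' : List (Fin (N + 1))} (hw : IsTuningPair Γ O w w')
    (h₁ : IsTuningPair Γ O w₁ w₁') (hi : IsIrreducibleWord w₁')
    (h : InWindow O w₁ w₁' (wrep w)) {X : ℕ → Fin (N + 1)}
    (hX : ∀ k < w.length, X k = wrep w' k) (hle : SeqLE O (cat w₁' (wrep w₁)) X) :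
    ∃ s, s.length = w.length ∧ SignedShift.sgn O s = -1 ∧ cat s (wrep w₁) = cat w₁' (wrep w₁) ∧
      X = cat s (shift w.length X) := by
  obtain ⟨v, hv, hwv⟩ := T.exists_tune h₁ hi hw.1 h
  have hlen : w.length = v.length * w₁.length := by rw [hwv, length_tune h₁.length_eq]
  obtain ⟨k, hk⟩ : ∃ k, v.length = k + 1 :=
    ⟨v.length - 1, by have := two_le_length_of_admissible hv; omega⟩
  have hsl : (w₁' ++ wpow w₁ k).length = w.length := by
    rw [List.length_append, length_wpow, h₁.length_eq, hlen, hk]; ring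
  have hss : SignedShift.sgn O (w₁' ++ wpow w₁ k) = -1 := by
    rw [sgn_append, sgn_wpow, h₁.1.2, h₁.2.2.1]; simp
  have hsc : cat (w₁' ++ wpow w₁ k) (wrep w₁) = cat w₁' (wrep w₁) := by
    rw [cat_append, cat_wpow_of_cat (cat_wrep w₁)]
  have hsp : IsPeriodicWord Γ (w₁' ++ wpow w₁ k) := by
    rcases eq_or_ne k 0 with rfl | h0
    · simpa using h₁.2.1.1
    · exact h₁.2.1.1.append (h₁.1.1.1.wpow h0)
  generalize w₁' ++ wpow w₁ k = s at hsl hss hsc hsp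
  refine ⟨s, hsl, hss, hsc, ?_⟩
  have hlt : LTb O w.length (wrep w) (cat w₁' (wrep w₁)) := by
    refine (h.2.ltb_or_agree w.length).resolve_right fun hag => ?_
    have h2 := psgn_congr (O := O) hag
    rw [psgn_wrep, ← hsc, ← hsl, ← sgn_pre (cat s (wrep w₁)), pre_cat, hss, hw.1.2] at h2
    exact absurd h2 (by decide)
  have hnb : ¬ LTb O w.length (cat s (wrep w₁)) (cat w' (wrep w')) := fun h3 =>
    hw.not_between (x := wrep w) (t := wrep w₁) hsp hsl h3 (by rw [cat_wrep, hsc]; exact hlt)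
  rw [hsc, cat_wrep] at hnb
  have hag := (hle.ltb_or_agree w.length).resolve_left fun h3 =>
    hnb (h3.congr (fun _ _ => rfl) hX)
  have := eq_cat_shift (u := s) (x := X) (y := wrep w₁) fun j hj => by
    rw [hsc, hag j (by omega)]
  rwa [hsl] at this

/-- `x` lies in no window of a tuning pair with irreducible second word. -/
def NoWindow (Γ : Digraph (Fin (N + 1))) (O : Fin (N + 1) → ℤˣ) (x : ℕ → Fin (N + 1)) : Prop :=
  ∀ w w', IsTuningPair Γ O w w' → IsIrreducibleWord w' → ¬ InWindow O w w' x

/-- Below a sequence `x` outside of all windows that starts with `w'`, the word `w` of a tuning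
pair `(w, w')` can be replaced by one that lies in no window either: take the shortest pair whose
window contains `w^∞`. -/
theorem Base.exists_noWindow {g : List (Fin (N + 1))} (T : Base Γ O g)
    {w w' : List (Fin (N + 1))} (hw : IsTuningPair Γ O w w') {x : ℕ → Fin (N + 1)}
    (hx : NoWindow Γ O x) (hxw : ∀ k < w.length, x k = wrep w' k)
    (hlow : SeqLE O (wrep w') x) (hM : SeqLT O (shift w.length x) (wrep w)) :
    ∃ w₁, IsAdmissible Γ O w₁ ∧ w₁.length ≤ w.length ∧ NoWindow Γ O (wrep w₁) ∧
      SeqLT O (shift w.length x) (wrep w₁) ∧ SeqLT O (wrep w₁) x := by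
  have hwx : LTb O w.length (wrep w) x := hw.wrep_ltb.trans_le hlow
  by_cases hno : NoWindow Γ O (wrep w)
  · exact ⟨w, hw.1, le_rfl, hno, hM, hwx.seqLT⟩
  have hex : ∃ n, ∃ w₁ w₁', w₁.length = n ∧ IsTuningPair Γ O w₁ w₁' ∧ IsIrreducibleWord w₁' ∧
      InWindow O w₁ w₁' (wrep w) := by
    unfold NoWindow at hno
    push Not at hno
    obtain ⟨w₁, w₁', h⟩ := hno
    exact ⟨_, w₁, w₁', rfl, h⟩
  classical
  obtain ⟨w₁, w₁', hn, h₁, hi₁, hin⟩ := Nat.find_spec hex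
  have hmin : ∀ w₂ w₂', IsTuningPair Γ O w₂ w₂' → IsIrreducibleWord w₂' →
      InWindow O w₂ w₂' (wrep w) → w₁.length ≤ w₂.length := fun w₂ w₂' a b c => by
    rw [hn]; exact Nat.find_min' hex ⟨w₂, w₂', rfl, a, b, c⟩
  have hlt₁ : LTb O w₁.length (wrep w₁) (wrep w) := h₁.wrep_ltb.trans_le hin.1
  have hxtip : SeqLT O (cat w₁' (wrep w₁)) x :=
    (seqLT_or_le O _ _).resolve_right fun h =>
      hx w₁ w₁' h₁ hi₁ ⟨hin.1.trans hwx.le, h⟩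
  refine ⟨w₁, h₁.1, (T.length_lt_of_inWindow hw.1 h₁ hi₁ hin).le, ?_, ?_,
    (hlt₁.trans hwx).seqLT⟩
  · intro w₂ w₂' h₂ hi₂ hin₂
    have hl₂ := T.length_lt_of_inWindow h₁.1 h₂ hi₂ hin₂
    refine absurd (hmin w₂ w₂' h₂ hi₂ ⟨hin₂.1.trans hlt₁.le, ?_⟩) (by omega)
    rcases seqLT_or_le O (cat w₂' (wrep w₂)) (wrep w) with h | h
    swap
    · exact h
    exfalso
    have hag := hin.agree
    rw [h₁.length_eq] at hag
    obtain ⟨s, -, hss, hsc, hse⟩ := T.exists_tip h₁ h₂ hi₂ hin₂ hag (Or.inl h)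
    obtain ⟨n, h⟩ := seqLT_iff.1 h
    have hE : SeqLT O (shift w₁.length (wrep w)) (wrep w₂) := by
      rw [← hsc, hse] at h
      exact ((h.mono (Nat.le_add_left n s.length)).of_cat_neg hss).seqLT
    obtain ⟨m, hE⟩ := seqLT_iff.1 hE
    have h3 := hin.eq_cat
    have h4 := hin.2
    rw [h3, h₁.length_eq] at h4
    have h5 := h4.of_cat_neg h₁.2.2.1
    exact ((h5.trans_ltb hE).trans (h₂.wrep_ltb.trans_le hin₂.1)).irrefl
  · obtain ⟨s, -, hss, hsc, hse⟩ := T.exists_tip hw h₁ hi₁ hin hxw (Or.inl hxtip)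
    obtain ⟨n, h⟩ := seqLT_iff.1 hxtip
    rw [← hsc, hse] at h
    exact ((h.mono (Nat.le_add_left n s.length)).of_cat_neg hss).seqLT

/-! ### Existence of escaping words -/

theorem Base.shift_wpow_ltb {g : List (Fin (N + 1))} (T : Base Γ O g) {x : ℕ → Fin (N + 1)}
    (hx0 : x 0 = Fin.last N)
    (hx : ∀ y : ℕ → Fin (N + 1), y 0 = Fin.last N → LTb O (g.length + 1) (cat g y) x)
    {K j : ℕ} (hj : j < (wpow g K).length) {z : ℕ → Fin (N + 1)} (hz : z 0 = Fin.last N) :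
    LTb O (g.length + 1) (shift j (cat (wpow g K) z)) x := by
  have hl := T.periodic.length_pos
  rw [length_wpow] at hj
  obtain ⟨d, s, hd, hs, rfl⟩ : ∃ d s, d < K ∧ s < g.length ∧ j = d * g.length + s :=
    ⟨j / g.length, j % g.length, Nat.div_lt_of_lt_mul (by rwa [Nat.mul_comm] at hj),
      Nat.mod_lt _ hl, (Nat.div_add_mod' j g.length).symm⟩
  obtain ⟨c, rfl⟩ : ∃ c, K = d + (c + 1) := ⟨K - d - 1, by omega⟩
  rw [wpow_add, cat_append, ← length_wpow, shift_cat, wpow_succ, cat_append]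
  rcases Nat.eq_zero_or_pos s with rfl | h0
  · refine hx _ ?_
    cases c with
    | zero => simpa using hz
    | succ c => rw [wpow_succ, cat_append, T.periodic.cat_zero]
  · refine ltb_of_zero_lt (by omega) ?_
    rw [shift_apply_zero, hx0, ← wrep_eq_cat_of_lt hs]
    exact Fin.lt_last_iff_ne_last.2 (T.ne_last s h0 hs)

/-- The irreducible root of an admissible word outside of all windows is again positive. -/
theorem Base.exists_admissible_root {g : List (Fin (N + 1))} (T : Base Γ O g)
    {w : List (Fin (N + 1))} (hw : IsAdmissible Γ O w) (hno : NoWindow Γ O (wrep w))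
    (hg : wrep w ≠ wrep g) :
    ∃ u k, IsAdmissible Γ O u ∧ IsIrreducibleWord u ∧ k ≠ 0 ∧ w = wpow u k := by
  obtain ⟨u, k, hui, hk, hwu⟩ := exists_irreducible_root w hw.1.1.ne_nil
  have hur : wrep u = wrep w := by rw [hwu, wrep_wpow hui.ne_nil hk]
  have hul : 0 < u.length := List.length_pos_iff.2 hui.ne_nil
  have hue : IsExtremal Γ O u := by
    refine ⟨⟨?_, by rw [hur]; exact hw.1.1.2⟩, by rw [hur]; exact hw.1.2⟩
    have h0 := hw.1.2.2.1
    rw [← hur, wrep_eq_cat_of_lt hul (wrep w), cat_of_lt hul] at h0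
    rw [List.head?_eq_getElem?, List.getElem?_eq_getElem hul, h0]
  refine ⟨u, k, ⟨hue, (sgn_eq_one_or _).resolve_right fun hneg => ?_⟩, hui, hk, hwu⟩
  rcases T.dichotomy u hue hui hneg with rfl | ⟨b, hb⟩
  · exact hg hur.symm
  · refine hno b u hb hui ⟨?_, ?_⟩
    · rw [hur]; exact SeqLE.refl _
    · rw [← hur]; exact IsTuningPair.wrep_le_tip hb

/-- Words outside of all windows have escaping words. By the choice of the longest border `w'` of
`α`, every continuation larger than the one of `w'` in `α^∞` is permitted after powers of `α`.
If `(w, w')` is a tuning pair, such a continuation is `w^∞`, since `α^∞` is not in its window;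
it leads to a shorter word in place of `α`. -/
theorem Base.exists_escapes {g : List (Fin (N + 1))} (T : Base Γ O g)
    (hconn : StronglyConnected Γ) (α : List (Fin (N + 1))) (hα : IsAdmissible Γ O α)
    (hi : IsIrreducibleWord α) (hg : wrep α ≠ wrep g) (hno : NoWindow Γ O (wrep α)) :
    ∃ q, Escapes Γ O α q := by
  induction hn : α.length using Nat.strong_induction_on generalizing α with
  | _ n ih =>
  have hT := hα.1.isTop hi
  have hx0 := hα.1.2.2.1
  have hgN := (T.eq_or_ltb hconn hα.1.2).resolve_left hg
  by_cases hA : ∀ r, IsBorder (wrep α) α.length r → wrep α r ≠ Fin.last N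
  · -- no border is followed by `N`, and `g` escapes
    refine ⟨g, T.periodic, fun j hj => ⟨g.length + 1, fun z hz => ?_⟩,
      fun r hr => ⟨1, fun z _ => ltb_of_zero_lt one_pos ?_⟩⟩
    · have := T.shift_wpow_ltb hx0 hgN (K := 1) (j := j) (by simpa using hj) hz
      rwa [wpow_one] at this
    · rw [shift_apply_zero, T.periodic.cat_zero]
      exact Fin.lt_last_iff_ne_last.2 (hA r hr)
  push Not at hA
  obtain ⟨r₀, hr₀, hr₀N⟩ := hA
  classical
  obtain ⟨r, hr, hrmax⟩ : ∃ r, IsBorder (wrep α) α.length r ∧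
      ∀ s, IsBorder (wrep α) α.length s → s ≤ r :=
    ⟨Nat.findGreatest (IsBorder (wrep α) α.length) α.length,
      Nat.findGreatest_spec hr₀.2.1.le hr₀, fun s hs => Nat.le_findGreatest hs.2.1.le hs⟩
  have hmono : ∀ s, IsBorder (wrep α) α.length s →
      SeqLE O (shift s (wrep α)) (shift r (wrep α)) :=
    fun s hs => hT.shift_mono hs hr (hrmax s hs)
  obtain ⟨x, hxα⟩ : ∃ x, x = wrep α := ⟨_, rfl⟩
  rw [← hxα] at hT hx0 hgN hr₀ hr₀N hr hrmax hmono hno hg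
  have hxp : x ∈ paths Γ := by rw [hxα]; exact hα.1.1.2
  have hrN : x r = Fin.last N := by
    have := (hmono r₀ hr₀).zero_le
    rwa [shift_apply_zero, shift_apply_zero, hr₀N, Fin.last_le_iff] at this
  obtain ⟨τ, hτ⟩ : ∃ τ, τ = pre x r := ⟨_, rfl⟩
  have hτl : τ.length = r := by rw [hτ, length_pre]
  have hxτ : x = cat τ (shift r x) := by rw [hτ, cat_pre_shift]
  have hτp : IsPeriodicWord Γ τ := by
    rw [hτ]; exact isPeriodicWord_pre (fun k _ => hxp k) hx0 hr.1 hrN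
  have hτs : SignedShift.sgn O τ = -1 := by rw [hτ]; exact hT.sgn_border hr
  obtain ⟨hτe, hτi⟩ := isExtremal_of_strict (O := O) hτp fun j h0 hj => by
    rw [hτl] at hj
    rw [hτ]; exact hT.border_strict hr j h0 hj
  rcases T.dichotomy τ hτe hτi hτs with rfl | ⟨w, hw⟩
  · have := hgN (shift r x) (by rw [shift_apply_zero, hrN])
    rw [← hxτ] at this
    exact absurd this LTb.irrefl
  have hwr : w.length = r := by rw [← hw.length_eq, hτl]
  have hlow : SeqLE O (wrep τ) x := by
    refine le_of_cat_le hτp.ne_nil (cat_wrep τ) ?_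
    have := (hT.le r).cat_neg hτs
    rwa [← hxτ] at this
  have hM : SeqLT O (shift w.length x) (wrep w) := by
    have h1 : SeqLT O (cat τ (wrep w)) x :=
      (seqLT_or_le O _ _).resolve_right fun h => hno w τ hw hτi ⟨hlow, h⟩
    obtain ⟨m, h1⟩ := seqLT_iff.1 h1
    rw [hxτ] at h1
    rw [hwr]
    exact ((h1.mono (Nat.le_add_left m τ.length)).of_cat_neg hτs).seqLT
  obtain ⟨w₁, hw₁, hl₁, hno₁, hM₁, hx₁⟩ := T.exists_noWindow hw hno (fun k hk => by
    rw [hxτ]; exact (wrep_eq_cat_of_lt (by omega) _).symm) hlow hM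
  rw [hwr] at hM₁
  obtain ⟨L, hL⟩ := seqLT_iff.1 hM₁
  have hborder : ∀ q (s : ℕ), (∀ k < L, ∀ z, cat q z k = wrep w₁ k) → IsBorder x α.length s →
      ∀ z : ℕ → Fin (N + 1), LTb O L (shift s x) (cat q z) := fun q s hq hs z =>
    ((hmono s hs).trans_ltb hL).congr (fun _ _ => rfl) fun k hk => (hq k hk z).symm
  by_cases hg₁ : wrep w₁ = wrep g
  · have hgl := T.periodic.length_pos
    refine ⟨wpow g (L + 1), T.periodic.wpow (by omega), fun j hj => ⟨g.length + 1, fun z hz => ?_⟩,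
      fun s hs => ⟨L, fun z _ => ?_⟩⟩
    · rw [← hxα]
      exact T.shift_wpow_ltb hx0 hgN hj hz
    · rw [← hxα] at hs ⊢
      refine hborder _ s (fun k hk z => ?_) hs z
      rw [hg₁, ← cat_wpow_of_cat (cat_wrep g) (L + 1)]
      refine cat_congr_lt ?_
      rw [length_wpow]; nlinarith
  -- the irreducible root of `w₁` is admissible and shorter than `α`
  obtain ⟨u, k, hu, hui, hk, hwu⟩ := T.exists_admissible_root hw₁ hno₁ hg₁
  have hur : wrep u = wrep w₁ := by rw [hwu, wrep_wpow hui.ne_nil hk]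
  have hul : 0 < u.length := List.length_pos_iff.2 hui.ne_nil
  have hule : u.length ≤ w₁.length := by
    rw [hwu, length_wpow]; exact Nat.le_mul_of_pos_left _ (Nat.pos_of_ne_zero hk)
  obtain ⟨q, hq⟩ := ih u.length (by have := hr.2.1; omega) u hu hui (by rwa [hur])
    (by rwa [hur]) rfl
  refine ⟨wpow u L ++ q, hu.1.1.wpow_append hq.periodic L, fun j hj => ?_,
    fun s hs => ⟨L, fun z _ => ?_⟩⟩
  · obtain ⟨L', hL'⟩ := hq.append_shift_ltb hu hui L hj
    refine ⟨L', fun z hz => ?_⟩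
    rw [← hxα]
    refine (hL' z hz).trans_le ?_
    rw [hur]; exact Or.inl hx₁
  · rw [← hxα] at hs ⊢
    refine hborder _ s (fun k hk z => ?_) hs z
    rw [cat_append, ← hur, ← cat_wpow_of_cat (cat_wrep u) L]
    refine cat_congr_lt ?_
    rw [length_wpow]; nlinarith

/-! ### Connecting two admissible words -/

/-- Let `t` end in a power of `b`, and let `S` start with a long part of `x > b^∞`. Then
`t S ≤ S`: either `t` already differs from `x`, or `t` is a negative prefix of `x`. -/
theorem cat_le_of_suffix {b x S : ℕ → Fin (N + 1)} {t : List (Fin (N + 1))} (ht : t ≠ [])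
    {L : ℕ} (hbx : LTb O L b x) (htb : SeqLE O (cat t b) b) (hb : ∀ n, SeqLE O (shift n b) b)
    (hx : ∀ n, SeqLE O (shift n x) x) (hS : ∀ k < L, S k = x k)
    (hSS : t.length < L → SeqLE O (shift t.length S) S) : SeqLE O (cat t S) S := by
  have htx : LTb O L (cat t b) x := htb.trans_ltb hbx
  rcases lt_or_ge t.length L with hl | hl
  swap
  · exact (htx.congr (fun k hk => cat_congr_lt (by omega)) fun k hk => (hS k hk).symm).le
  rcases LTb.trichotomy O t.length (cat t S) x with h | h | h
  · exact (h.congr (fun _ _ => rfl) fun k hk => (hS k (by omega)).symm).le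
  · rcases sgn_eq_one_or (O := O) t with hpos | hneg
    · exfalso
      have hag : ∀ k < t.length, b k = x k := by
        rcases LTb.trichotomy O t.length b x with h1 | h1 | h1
        · refine absurd (fun k hk => ?_) (htb.trans_ltb h1).not_agree
          rw [← h k hk]; exact cat_congr_lt hk
        · exact h1
        · exact absurd h1 hbx.asymm
      have e1 := eq_cat_shift (u := t) (x := b) (y := S) fun k hk => by rw [h k hk, hag k hk]
      have e2 := eq_cat_shift (u := t) (x := x) (y := S) fun k hk => (h k hk).symm
      have h2 : SeqLE O b (shift t.length b) := by
        have := htb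
        conv at this => rhs; rw [e1]
        exact this.of_cat_pos hpos
      rw [(hb _).antisymm h2] at e1
      have h3 := (le_of_le_cat ht e1.symm (by rw [← e2]; exact hx _)).cat_pos hpos
      rw [← e1, ← e2] at h3
      exact h3.not_lt hbx
    · have e := eq_cat_shift (u := t) (x := S) (y := S) fun k hk => by
        rw [hS k (by omega), h k hk]
      conv => rhs; rw [e]
      exact (hSS hl).cat_neg hneg
  · refine absurd (h.congr (fun _ _ => rfl) fun k hk => ?_) (htx.mono (m := L) le_rfl).asymm
    exact cat_congr_lt hk

/-- If `q` escapes from `α`, the words `α^K q g^e b^n` with large `K` are maximal. -/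
theorem Base.wrep_admissible {g : List (Fin (N + 1))} (T : Base Γ O g)
    (hconn : StronglyConnected Γ) {α q b : List (Fin (N + 1))} (hα : IsAdmissible Γ O α)
    (hi : IsIrreducibleWord α) (hg : wrep α ≠ wrep g) (hq : Escapes Γ O α q)
    (hb : IsAdmissible Γ O b) (hba : SeqLT O (wrep b) (wrep α)) (e : ℕ) {n : ℕ} (hn : n ≠ 0) :
    ∃ L, ∀ K, L ≤ (wpow α K).length →
      IsExtremal Γ O (wpow α K ++ (q ++ (wpow g e ++ wpow b n))) := by
  have hgN := (T.eq_or_ltb hconn hα.1.2).resolve_left hg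
  have hl := hα.1.1.length_pos
  obtain ⟨Lb, hLb⟩ := seqLT_iff.1 hba
  obtain ⟨L₁, hL₁⟩ := hq.wpow_shift_ltb hα hi
  have hex : ∀ j, ∃ L, j < q.length → ∀ z : ℕ → Fin (N + 1), z 0 = Fin.last N →
      LTb O L (shift j (cat q z)) (wrep α) := fun j => by
    by_cases hj : j < q.length
    · obtain ⟨L, hL⟩ := hq.inner j hj
      exact ⟨L, fun _ => hL⟩
    · exact ⟨0, fun h => absurd h hj⟩
  choose L₂ hL₂ using hex
  refine ⟨L₁ + ∑ j ∈ Finset.range q.length, L₂ j + (g.length + 1) + Lb, fun K hK => ?_⟩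
  have hbn : IsPeriodicWord Γ (wpow b n) := hb.1.1.wpow hn
  have hWp : IsPeriodicWord Γ (wpow α K ++ (q ++ (wpow g e ++ wpow b n))) :=
    hα.1.1.wpow_append (hq.periodic.append (T.periodic.wpow_append hbn e)) K
  obtain ⟨W, hW⟩ : ∃ W, W = wpow α K ++ (q ++ (wpow g e ++ wpow b n)) := ⟨_, rfl⟩
  rw [← hW] at hWp ⊢
  obtain ⟨S, hS⟩ : ∃ S, S = wrep W := ⟨_, rfl⟩
  obtain ⟨Z, hZ⟩ : ∃ Z, Z = cat (wpow g e) (cat (wpow b n) S) := ⟨_, rfl⟩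
  have hZ0 : Z 0 = Fin.last N := by
    cases e with
    | zero => rw [hZ, wpow_zero, cat_nil, hbn.cat_zero]
    | succ e => rw [hZ, wpow_succ, cat_append, T.periodic.cat_zero]
  have hSZ : S = cat (wpow α K) (cat q Z) := by
    rw [hZ]
    conv_lhs => rw [hS, ← cat_wrep, hW, cat_append, cat_append, cat_append, ← hW, ← hS]
  have hSx : ∀ k < (wpow α K).length, S k = wrep α k := fun k hk => by
    rw [hSZ, ← cat_wpow_of_cat (cat_wrep α) K]
    exact cat_congr_lt hk
  have hfin : ∀ y : ℕ → Fin (N + 1), LTb O (wpow α K).length y (wrep α) → SeqLE O y S :=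
    fun y hy => (hy.congr (fun _ _ => rfl) fun k hk => (hSx k hk).symm).le
  -- tails that start inside of the power of `α`
  have h₁ : ∀ j < (wpow α K).length, SeqLE O (shift j S) S := by
    intro j hj
    by_cases hd : α.length ∣ j
    · obtain ⟨d, rfl⟩ := hd
      rw [length_wpow, Nat.mul_comm K] at hj
      obtain ⟨c, rfl⟩ := Nat.exists_eq_add_of_lt (Nat.lt_of_mul_lt_mul_left hj)
      obtain ⟨M, hM⟩ := hq.wpow_ltb hα (c + 1)
      have hM := hM Z hZ0
      rcases Nat.eq_zero_or_pos d with rfl | hd0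
      · exact SeqLE.refl _
      rw [hSZ, Nat.add_assoc, wpow_add, cat_append, Nat.mul_comm, ← length_wpow,
        shift_length_cat]
      rcases seqLT_or_le O (cat (wpow α d) (cat (wpow α (c + 1)) (cat q Z)))
        (cat (wpow α (c + 1)) (cat q Z)) with h | h
      · exact absurd hM (le_of_cat_le (wpow_ne_nil hi.ne_nil hd0.ne')
          (cat_wpow_of_cat (cat_wrep α) d) (Or.inl h)).not_lt
      · exact h
    · refine hfin _ ((?_ : LTb O L₁ _ _).mono (by omega))
      rw [hSZ]
      exact hL₁ K Z hZ0 j (by simpa using hj) hd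
  have hall : ∀ j < W.length, SeqLE O (shift j S) S := by
    intro j hj
    rw [hW] at hj
    simp only [List.length_append] at hj
    rcases lt_or_ge j (wpow α K).length with hj₁ | hj₁
    · exact h₁ j hj₁
    obtain ⟨j, rfl⟩ := Nat.exists_eq_add_of_le hj₁
    have e1 : shift ((wpow α K).length + j) S = shift j (cat q Z) := by rw [hSZ, shift_cat]
    rw [e1]
    rcases lt_or_ge j q.length with hj₂ | hj₂
    · refine hfin _ ((hL₂ j hj₂ Z hZ0).mono ?_)
      have := Finset.single_le_sum (f := L₂) (fun _ _ => Nat.zero_le _) (Finset.mem_range.2 hj₂)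
      omega
    obtain ⟨j, rfl⟩ := Nat.exists_eq_add_of_le hj₂
    rw [shift_cat, hZ]
    rcases lt_or_ge j (wpow g e).length with hj₃ | hj₃
    · exact hfin _ ((T.shift_wpow_ltb hα.1.2.2.1 hgN hj₃ (hbn.cat_zero _)).mono (by omega))
    obtain ⟨j, rfl⟩ := Nat.exists_eq_add_of_le hj₃
    have hj₄ : j < (wpow b n).length := by omega
    rw [shift_cat, shift_cat_drop _ _ hj₄.le]
    refine cat_le_of_suffix (L := Lb) ?_ hLb ?_ hb.1.2.2.2 hα.1.2.2.2
      (fun k hk => hSx k (by omega)) fun h => h₁ _ (by omega)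
    · rw [← List.length_pos_iff, List.length_drop]; omega
    · rw [← shift_cat_drop _ _ hj₄.le, cat_wpow_of_cat (cat_wrep b)]
      exact hb.1.2.2.2 j
  refine ⟨hWp, hWp.2, hWp.wrep_zero, fun m => ?_⟩
  rw [← shift_mod_of_shift (shift_length_wrep W) m, ← hS]
  exact hall _ (Nat.mod_lt _ hWp.length_pos)

end SignedShift

theorem mainTheorem3 (N : ℕ) (Γ : Digraph (Fin (N + 1))) (O : Fin (N + 1) → ℤˣ)
    (hconn : SignedShift.StronglyConnected Γ) (haper : SignedShift.Aperiodic Γ)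
    (htun : SignedShift.IsTunable Γ O)
    (a b : List (Fin (N + 1)))
    (ha : SignedShift.IsNonrenormalizable Γ O a)
    (hb : SignedShift.IsAdmissible Γ O b)
    (hba : SignedShift.SeqLE O (SignedShift.wrep b) (SignedShift.wrep a))
    (n : ℕ) (hn : 0 < n) :
    ∃ c : List (Fin (N + 1)),
      SignedShift.IsAdmissible Γ O
        (SignedShift.wpow a n ++ c ++ SignedShift.wpow b n) := by
  open SignedShift in
  obtain ⟨g, T⟩ := htun.exists_base
  obtain ⟨ha, hnot⟩ := ha
  rcases hba with hba | hba
  swap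
  · -- both words are powers of one word, and the powers themselves can be joined
    refine ⟨[], ?_⟩
    rw [List.append_nil]
    have hp : IsPeriodicWord Γ (wpow a n ++ wpow b n) :=
      (ha.1.1.wpow hn.ne').append (hb.1.1.wpow hn.ne')
    have hr : wrep (wpow a n ++ wpow b n) = wrep a := by
      refine (eq_wrep hp.ne_nil ?_).symm
      rw [cat_append, ← hba, cat_wpow_of_cat (cat_wrep b), hba, cat_wpow_of_cat (cat_wrep a)]
    refine ⟨⟨hp, by rw [hr]; exact ha.1.2⟩, ?_⟩
    rw [sgn_append, sgn_wpow, sgn_wpow, ha.2, hb.2, one_pow, one_mul]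
  have hno : NoWindow Γ O (wrep a) := fun w w' hw hi hin => by
    obtain ⟨v, hv, hav⟩ := T.exists_tune hw hi ha hin
    exact hnot ⟨w, w', v, hw, hv, hav⟩
  have hg : wrep a ≠ wrep g := by
    intro h
    rw [h] at hba
    obtain ⟨m, hm⟩ := seqLT_iff.1 hba
    rcases T.eq_or_ltb hconn hb.1.2 with h' | h'
    · rw [h'] at hm; exact hm.irrefl
    · have := h' (wrep g) T.periodic.wrep_zero
      rw [cat_wrep] at this
      exact this.asymm hm
  obtain ⟨α, k, hα, hi, hk, hak⟩ := T.exists_admissible_root ha hno hg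
  have hαa : wrep α = wrep a := by rw [hak, wrep_wpow hi.ne_nil hk]
  rw [← hαa] at hno hg hba
  obtain ⟨q, hq⟩ := T.exists_escapes hconn α hα hi hg hno
  -- the factor `g` adjusts the sign
  obtain ⟨e, he⟩ : ∃ e, sgn O (q ++ wpow g e) = 1 := by
    rcases sgn_eq_one_or (O := O) q with h | h
    · exact ⟨0, by simp [h]⟩
    · exact ⟨1, by simp [sgn_append, h, T.sgn]⟩
  obtain ⟨L, hL⟩ := T.wrep_admissible hconn hα hi hg hq hb hba e hn.ne'
  refine ⟨wpow a L ++ (q ++ wpow g e), ?_⟩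
  have hW : wpow a n ++ (wpow a L ++ (q ++ wpow g e)) ++ wpow b n =
      wpow α (k * (n + L)) ++ (q ++ (wpow g e ++ wpow b n)) := by
    rw [wpow_mul, ← hak, wpow_add]
    simp only [List.append_assoc]
  refine ⟨?_, ?_⟩
  · rw [hW]
    refine hL _ ?_
    rw [wpow_mul, ← hak, length_wpow]
    have := ha.1.1.length_pos
    nlinarith
  · rw [sgn_append, sgn_append, sgn_append, he, sgn_wpow, sgn_wpow, sgn_wpow, ha.2, hb.2]
    simp
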